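/- **Lemma (Energy Pythagorean expansion).** For $f\in H^1(\mathbb R^3;\mathbb C)$ let $E[f]=\frac12\int_{\mathbb R^3}|\nabla f|^2\,dx-\frac14\int_{\mathbb R^3}|f|^4\,dx$, and let $e^{it\Delta}$ be the free Schrödinger propagator. Fix numbers $6^-\in[3,6)$ and $4^+\in(4,\infty]$ and let $$\|u\|_{S(\dot H^{1/2})}=\sup\Big\{\|u\|_{L^q_tL^r_x(\mathbb R\times\mathbb R^3)}:\ \tfrac2q+\tfrac3r=1,\ 3\le r\le 6^-,\ 4^+\le q\le\infty\Big\}.$$ Let $(\phi_n)_{n}$ be a bounded sequence in $H^1(\mathbb R^3)$ with a profile expansion, that is: there are profiles $\psi^j\in H^1$, time shifts $t_n^j\in\mathbb R$, space shifts $x_n^j\in\mathbb R^3$ ($j\ge1$) and remainders $W_n^M\in H^1$ ($M\ge1$) such that 1. for all $M\ge1$ and all $n$, $\ \phi_n(x)=\sum_{j=1}^M \big(e^{-it_n^j\Delta}\psi^j\big)(x-x_n^j)+W_n^M(x)$; 2. for all $j\ne k$, $\ |t_n^j-t_n^k|+|x_n^j-x_n^k|\to+\infty$ as $n\to\infty$;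 3. $\lim_{M\to\infty}\big[\limsup_{n\to\infty}\|e^{it\Delta}W_n^M\|_{S(\dot H^{1/2})}\big]=0$; 4. for each $M\ge1$ and each $0\le s\le1$, $\ \|\phi_n\|_{\dot H^s}^2=\sum_{j=1}^M\|\psi^j\|_{\dot H^s}^2+\|W_n^M\|_{\dot H^s}^2+o_n(1)$. Then for each fixed $M\ge1$, as $n\to\infty$, $$E[\phi_n]=\sum_{j=1}^M E\big[e^{-it_n^j\Delta}\psi^j\big]+E[W_n^M]+o_n(1).$$ -/

import Mathlib

open MeasureTheory Filter Topology FourierTransform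
open scoped ENNReal SchwartzMap LineDeriv

noncomputable section

namespace NLS

/-- Physical space `ℝ³` with its Euclidean norm. -/
abbrev Space : Type := EuclideanSpace ℝ (Fin 3)

/-- Complex-valued `L²(ℝ³)`. -/
abbrev L2 : Type := Lp ℂ 2 (volume : Measure Space)

/-- `f ∈ H¹(ℝ³)`. -/
def IsH1 (f : L2) : Prop :=
  TemperedDistribution.MemSobolev 1 2 (f : 𝓢'(Space, ℂ))

/-- `g` is the `i`-th distributional partial derivative of `f`. -/
def IsWeakPartial (i : Fin 3) (f g : L2) : Prop :=
  ∂_{(EuclideanSpace.single i (1 : ℝ) : Space)} (f : 𝓢'(Space, ℂ)) = (g : 𝓢'(Space, ℂ))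

open Classical in
/-- The `i`-th weak partial derivative of `f` as an element of `L²`; it is only used for `f ∈ H¹`,
where it exists (and it is set to `0` where it does not). -/
def weakPartial (i : Fin 3) (f : L2) : L2 :=
  if h : ∃ g : L2, IsWeakPartial i f g then h.choose else 0

theorem IsH1.isWeakPartial {f : L2} (hf : IsH1 f) (i : Fin 3) :
    IsWeakPartial i f (weakPartial i f) := by
  have h : ∃ g : L2, IsWeakPartial i f g := by
    have h1 := TemperedDistribution.MemSobolev.lineDerivOp hf
      (m := (EuclideanSpace.single i (1 : ℝ) : Space))
    rw [sub_self] at h1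
    exact TemperedDistribution.memSobolev_zero_iff.mp h1
  rw [weakPartial, dif_pos h]
  exact h.choose_spec

/-- `|∇f(x)|²`. -/
def gradSq (f : L2) (x : Space) : ℝ := ∑ i : Fin 3, ‖weakPartial i f x‖ ^ 2

/-- The norm of `H¹(ℝ³)`. -/
def h1Norm (f : L2) : ℝ := √((∫ x, ‖f x‖ ^ 2) + ∫ x, gradSq f x)

/-- The energy `E[f] = ½ ∫ |∇f|² - ¼ ∫ |f|⁴`. -/
def energy (f : L2) : ℝ := 1 / 2 * (∫ x, gradSq f x) - 1 / 4 * ∫ x, ‖f x‖ ^ 4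

/-- The square of the homogeneous Sobolev norm of order `s`. With the convention
`𝓕 f ξ = ∫ exp (-2πi x·ξ) f x`, the operator `|∇|` has the symbol `2π|ξ|`. -/
def homSobolevSq (s : ℝ) (f : L2) : ℝ :=
  ∫ ξ, (2 * Real.pi * ‖ξ‖) ^ (2 * s) * ‖(𝓕 f : L2) ξ‖ ^ 2

/-- The symbol `exp (-i t |2πξ|²)` of `e^{itΔ}`. -/
def schrodingerSymbol (t : ℝ) (ξ : Space) : ℂ :=
  Complex.exp ((-(t * (2 * Real.pi * ‖ξ‖) ^ 2) : ℝ) * Complex.I)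

theorem norm_schrodingerSymbol (t : ℝ) (ξ : Space) : ‖schrodingerSymbol t ξ‖ = 1 :=
  Complex.norm_exp_ofReal_mul_I _

theorem memLp_schrodingerSymbol (t : ℝ) :
    MemLp (schrodingerSymbol t) ∞ (volume : Measure Space) := by
  refine memLp_top_of_bound (C := 1) ?_ (ae_of_all _ fun ξ => (norm_schrodingerSymbol t ξ).le)
  have : Continuous (schrodingerSymbol t) := by
    unfold schrodingerSymbol
    fun_prop
  exact this.aestronglyMeasurable

/-- The free Schrödinger propagator `e^{itΔ}` on `L²(ℝ³)`. -/
def schrodinger (t : ℝ) (f : L2) : L2 :=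
  𝓕⁻ ((memLp_schrodingerSymbol t).toLp • (𝓕 f : L2) : L2)

/-- The translate `f(· - a)`. -/
def translate (a : Space) (f : L2) : L2 :=
  Lp.compMeasurePreserving (fun y : Space => y - a) (measurePreserving_sub_right volume a) f

/-- The mixed norm of `L^q_t L^r_x` over `ℝ × ℝ³`. -/
def mixedNorm (q r : ℝ≥0∞) (u : ℝ → L2) : ℝ≥0∞ :=
  eLpNorm (fun τ : ℝ => eLpNorm (u τ) r volume) q volume

/-- The Strichartz norm `S(Ḣ^{1/2})`: the supremum of the mixed norms over the `Ḣ^{1/2}`-admissible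
pairs, `2/q + 3/r = 1`, in the range `3 ≤ r ≤ rmax`, `qmin ≤ q ≤ ∞`. Here `rmax` is the fixed
number `6⁻` and `qmin` the fixed number `4⁺`. -/
def strichartzNorm (qmin rmax : ℝ≥0∞) (u : ℝ → L2) : ℝ≥0∞ :=
  ⨆ (q : ℝ≥0∞) (r : ℝ≥0∞)
    (_ : 2 / q + 3 / r = 1 ∧ 3 ≤ r ∧ r ≤ rmax ∧ qmin ≤ q), mixedNorm q r u

/-- The data of a profile expansion of a bounded sequence in `H¹(ℝ³)`: profiles `ψ j`, time shifts
`t j n`, space shifts `x j n` (for `j ≥ 1`) and remainders `W M n` (for `M ≥ 1`), with the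
properties that make them a profile expansion of `φ n`. -/
structure IsProfileExpansion (qmin rmax : ℝ≥0∞) (φ : ℕ → L2) (ψ : ℕ → L2) (t : ℕ → ℕ → ℝ)
    (x : ℕ → ℕ → Space) (W : ℕ → ℕ → L2) : Prop where
  seq_mem : ∀ n, IsH1 (φ n)
  seq_bounded : ∃ C : ℝ, ∀ n, h1Norm (φ n) ≤ C
  profile_mem : ∀ j, 1 ≤ j → IsH1 (ψ j)
  remainder_mem : ∀ M, 1 ≤ M → ∀ n, IsH1 (W M n)
  expansion : ∀ M, 1 ≤ M → ∀ n,
    φ n = ∑ j ∈ Finset.Icc 1 M, translate (x j n) (schrodinger (-(t j n)) (ψ j)) + W M n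
  divergence : ∀ j k, 1 ≤ j → 1 ≤ k → j ≠ k →
    Tendsto (fun n => |t j n - t k n| + ‖x j n - x k n‖) atTop atTop
  remainder_small :
    Tendsto (fun M => limsup (fun n =>
      strichartzNorm qmin rmax (fun τ => schrodinger τ (W M n))) atTop) atTop (𝓝 0)
  pythagoras : ∀ M, 1 ≤ M → ∀ s : ℝ, 0 ≤ s → s ≤ 1 →
    Tendsto (fun n => homSobolevSq s (φ n) -
      (∑ j ∈ Finset.Icc 1 M, homSobolevSq s (ψ j) + homSobolevSq s (W M n))) atTop (𝓝 0)

end NLS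

end

noncomputable section

namespace NLS

/-! The kinetic part of the energy is the squared `Ḣ¹` norm, which the free flow preserves, so it is
additive by the Pythagorean hypothesis at `s = 1`. What remains is additivity of the fourth power of
the `L⁴` norm.

Distinct profiles decouple: the product of two of them tends to `0` in `L²`
(`tendsto_norm_mul44_of_diverging`). If a time shift escapes to infinity, that profile disperses in
`L⁴` (`tendsto_toL4_schrodinger`); if both times stay bounded, the space shifts separate and the
profiles part.

For fixed `M` the remainder `W M` need not be small. One goes on to a large `K ≥ M` for which `W K`
is small in `L⁴` (`eventually_norm_toL4_remainder_le`): its `L³` norm is controlled by the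
Strichartz norm at the pair `(∞, 3)`, its `L⁶` norm by Sobolev. Up to `W K`, `W M` is the sum of the
profiles `M + 1, …, K`, so orthogonality applies both to `φ` and to `W M`
(`tendsto_norm_pow_four_sub_of_expansion`). -/

/-- Complex-valued `L⁴(ℝ³)`. -/
abbrev L4 : Type := Lp ℂ 4 (volume : Measure Space)

/-! ### Translations and products of `L⁴` functions. -/

instance fact_one_le_four : Fact ((1 : ℝ≥0∞) ≤ 4) := ⟨by norm_num⟩

instance holderTriple_four_four_two : ENNReal.HolderTriple 4 4 2 where
  inv_add_inv_eq_inv := by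
    rw [← ENNReal.toReal_eq_toReal_iff' (by simp) (by simp),
      ENNReal.toReal_add (by simp) (by simp)]
    norm_num

/-- Translation by `a` on `Lᵖ`. -/
def shift (p : ℝ≥0∞) (a : Space) :
    Lp ℂ p (volume : Measure Space) →+ Lp ℂ p (volume : Measure Space) :=
  Lp.compMeasurePreserving (fun y : Space => y - a) (measurePreserving_sub_right volume a)

theorem coeFn_shift (p : ℝ≥0∞) (a : Space) (f : Lp ℂ p (volume : Measure Space)) :
    shift p a f =ᵐ[volume] fun y => f (y - a) :=
  Lp.coeFn_compMeasurePreserving f (measurePreserving_sub_right volume a)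

@[simp]
theorem norm_shift (p : ℝ≥0∞) (a : Space) (f : Lp ℂ p (volume : Measure Space)) :
    ‖shift p a f‖ = ‖f‖ :=
  Lp.norm_compMeasurePreserving f (measurePreserving_sub_right volume a)

theorem shift_shift (p : ℝ≥0∞) (a b : Space) (f : Lp ℂ p (volume : Measure Space)) :
    shift p a (shift p b f) = shift p (a + b) f := by
  apply Lp.ext
  have h := (measurePreserving_sub_right (volume : Measure Space) a).quasiMeasurePreserving.ae
    (coeFn_shift p b f)
  filter_upwards [coeFn_shift p a (shift p b f), coeFn_shift p (a + b) f, h] with y h1 h2 h3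
  rw [h1, h2, h3, sub_sub]

/-- The product of two `L⁴` functions in `L²`. -/
def mul44 (f g : L4) : L2 := f • g

theorem coeFn_mul44 (f g : L4) : mul44 f g =ᵐ[volume] fun x => f x * g x :=
  Lp.coeFn_lpSMul f g

theorem norm_mul44_le (f g : L4) : ‖mul44 f g‖ ≤ ‖f‖ * ‖g‖ := Lp.norm_smul_le f g

theorem add_mul44 (f g h : L4) : mul44 (f + g) h = mul44 f h + mul44 g h := Lp.smul_add f g h

theorem mul44_add (f g h : L4) : mul44 f (g + h) = mul44 f g + mul44 f h := Lp.add_smul f g h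

theorem zero_mul44 (f : L4) : mul44 0 f = 0 := Lp.zero_smul ℂ 4 f

theorem mul44_comm (f g : L4) : mul44 f g = mul44 g f := by
  apply Lp.ext
  filter_upwards [coeFn_mul44 f g, coeFn_mul44 g f] with x h1 h2
  rw [h1, h2, mul_comm]

theorem sum_mul44 {ι : Type*} (s : Finset ι) (f : ι → L4) (g : L4) :
    mul44 (∑ i ∈ s, f i) g = ∑ i ∈ s, mul44 (f i) g := by
  classical
  induction s using Finset.induction_on with
  | empty => simp [zero_mul44]
  | insert i s hi ih => rw [Finset.sum_insert hi, Finset.sum_insert hi, add_mul44, ih]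

theorem shift_mul44 (a : Space) (f g : L4) :
    shift 2 a (mul44 f g) = mul44 (shift 4 a f) (shift 4 a g) := by
  apply Lp.ext
  have h := (measurePreserving_sub_right (volume : Measure Space) a).quasiMeasurePreserving.ae
    (coeFn_mul44 f g)
  filter_upwards [coeFn_shift 2 a (mul44 f g), coeFn_mul44 (shift 4 a f) (shift 4 a g),
    coeFn_shift 4 a f, coeFn_shift 4 a g, h] with y h1 h2 h3 h4 h5
  rw [h1, h2, h3, h4, h5]

/-- Translating a whole product is an isometry of `L²`, so only the relative displacement counts. -/
theorem norm_mul44_shift_shift (a b : Space) (f g : L4) :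
    ‖mul44 (shift 4 a f) (shift 4 b g)‖ = ‖mul44 f (shift 4 (b - a) g)‖ := by
  rw [← norm_shift 2 a (mul44 f _), shift_mul44, shift_shift, add_sub_cancel]

/-! ### Expansion of the fourth power of the `L⁴` norm. -/

theorem L2_norm_sq (f : L2) : ‖f‖ ^ 2 = ∫ x, ‖f x‖ ^ 2 := by
  rw [Lp.norm_def, (Lp.memLp f).eLpNorm_eq_integral_rpow_norm (by norm_num) (by norm_num)]
  rw [ENNReal.toReal_ofReal (by positivity)]
  simp only [ENNReal.toReal_ofNat, Real.rpow_ofNat]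
  rw [← Real.rpow_natCast, ← Real.rpow_mul (by positivity)]
  norm_num

theorem L4_norm_pow (f : L4) : ‖f‖ ^ 4 = ∫ x, ‖f x‖ ^ 4 := by
  rw [Lp.norm_def, (Lp.memLp f).eLpNorm_eq_integral_rpow_norm (by norm_num) (by norm_num)]
  rw [ENNReal.toReal_ofReal (by positivity)]
  simp only [ENNReal.toReal_ofNat, Real.rpow_ofNat]
  rw [← Real.rpow_natCast, ← Real.rpow_mul (by positivity)]
  norm_num

theorem integrable_L4_pow (f : L4) : Integrable (fun x => ‖f x‖ ^ 4) volume := by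
  have := (Lp.memLp f).integrable_norm_pow (by norm_num)
  simpa using this

theorem integrable_L2_sq (f : L2) : Integrable (fun x => ‖f x‖ ^ 2) volume := by
  have := (Lp.memLp f).integrable_norm_pow (by norm_num)
  simpa using this

theorem integrable_norm_mul_norm (f g : L2) : Integrable (fun x => ‖f x‖ * ‖g x‖) volume := by
  have := (Lp.memLp f).norm.integrable_mul (Lp.memLp g).norm
  exact this

theorem integral_norm_mul_norm_le (f g : L2) : ∫ x, ‖f x‖ * ‖g x‖ ≤ ‖f‖ * ‖g‖ := by
  have h := integral_mul_norm_le_Lp_mul_Lq (f := f) (g := g) (μ := (volume : Measure Space))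
    Real.HolderConjugate.two_two (by simpa using Lp.memLp f) (by simpa using Lp.memLp g)
  simp only [Real.rpow_ofNat, ← L2_norm_sq, ← Real.sqrt_eq_rpow, Real.sqrt_sq (norm_nonneg _)] at h
  exact h

/-- Since `|a + b|² = |a|² + |b|² + d` with `|d| ≤ 2|a||b|`, squaring leaves only terms divisible by
`|a||b|`. The bound is written with products so that Cauchy–Schwarz in `L²` applies after
integration. -/
theorem abs_norm_add_pow_four_sub_le (a b : ℂ) :
    |‖a + b‖ ^ 4 - ‖a‖ ^ 4 - ‖b‖ ^ 4| ≤ 7 * (‖a * b‖ * (‖a * a‖ + ‖b * b‖)) := by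
  simp only [norm_mul]
  have h1 := norm_add_le a b
  have h2 : |‖a‖ - ‖b‖| ≤ ‖a + b‖ := by
    have := abs_norm_sub_norm_le a (-b)
    simpa using this
  have ha := norm_nonneg a
  have hb := norm_nonneg b
  have hc := norm_nonneg (a + b)
  generalize ‖a + b‖ = z at *
  generalize ‖a‖ = x at *
  generalize ‖b‖ = y at *
  have h3 : z ^ 2 ≤ (x + y) ^ 2 := by gcongr
  have h4 : (x - y) ^ 2 ≤ z ^ 2 := by
    rw [← sq_abs (x - y)]
    gcongr
  obtain ⟨d, hd⟩ : ∃ d, d = z ^ 2 - (x ^ 2 + y ^ 2) := ⟨_, rfl⟩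
  have hxy : 0 ≤ x * y := mul_nonneg ha hb
  have hd1 : d ≤ 2 * (x * y) := by nlinarith
  have hd2 : -(2 * (x * y)) ≤ d := by nlinarith
  have hA : 2 * (x * y) ≤ x ^ 2 + y ^ 2 := by nlinarith [sq_nonneg (x - y)]
  -- With `A = x² + y²`, the right side is at most `6(xy)² + 4Axy`, and `2xy ≤ A` turns this into
  -- `7Axy`.
  have hz : z ^ 4 - x ^ 4 - y ^ 4 = 2 * (x * y) ^ 2 + 2 * (x ^ 2 + y ^ 2) * d + d ^ 2 := by
    rw [hd]; ring
  have hd3 : d ^ 2 ≤ 4 * (x * y) ^ 2 := by nlinarith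
  have hA0 : 0 ≤ x ^ 2 + y ^ 2 := by positivity
  have h5 := mul_le_mul_of_nonneg_left hd1 hA0
  have h6 := mul_le_mul_of_nonneg_left hd2 hA0
  have h7 := mul_le_mul_of_nonneg_left hA hxy
  rw [hz, abs_le]
  constructor <;> nlinarith [sq_nonneg d]

theorem abs_L4_norm_add_pow_sub_le (f g : L4) :
    |‖f + g‖ ^ 4 - ‖f‖ ^ 4 - ‖g‖ ^ 4| ≤ 7 * (‖mul44 f g‖ * (‖f‖ ^ 2 + ‖g‖ ^ 2)) := by
  have hint := (integrable_norm_mul_norm (mul44 f g) (mul44 f f)).add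
    (integrable_norm_mul_norm (mul44 f g) (mul44 g g))
  calc |‖f + g‖ ^ 4 - ‖f‖ ^ 4 - ‖g‖ ^ 4|
      = |∫ x, (‖(f + g) x‖ ^ 4 - ‖f x‖ ^ 4 - ‖g x‖ ^ 4)| := by
        have h1 := integral_sub ((integrable_L4_pow (f + g)).sub (integrable_L4_pow f))
          (integrable_L4_pow g)
        have h2 := integral_sub (integrable_L4_pow (f + g)) (integrable_L4_pow f)
        simp only [Pi.sub_apply] at h1
        rw [h1, h2]
        simp only [L4_norm_pow]
    _ ≤ ∫ x, |‖(f + g) x‖ ^ 4 - ‖f x‖ ^ 4 - ‖g x‖ ^ 4| := abs_integral_le_integral_abs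
    _ ≤ ∫ x, 7 * (‖mul44 f g x‖ * ‖mul44 f f x‖ + ‖mul44 f g x‖ * ‖mul44 g g x‖) := by
        apply integral_mono_of_nonneg (ae_of_all _ fun _ => abs_nonneg _) (hint.const_mul 7)
        filter_upwards [Lp.coeFn_add f g, coeFn_mul44 f g, coeFn_mul44 f f, coeFn_mul44 g g]
          with x h1 h2 h3 h4
        simp only [Pi.add_apply, h1, h2, h3, h4, ← mul_add]
        exact abs_norm_add_pow_four_sub_le (f x) (g x)
    _ = 7 * ((∫ x, ‖mul44 f g x‖ * ‖mul44 f f x‖) + ∫ x, ‖mul44 f g x‖ * ‖mul44 g g x‖) := by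
        rw [integral_const_mul, integral_add (integrable_norm_mul_norm _ _)
          (integrable_norm_mul_norm _ _)]
    _ ≤ 7 * (‖mul44 f g‖ * ‖mul44 f f‖ + ‖mul44 f g‖ * ‖mul44 g g‖) := by
        gcongr <;> exact integral_norm_mul_norm_le _ _
    _ ≤ 7 * (‖mul44 f g‖ * (‖f‖ ^ 2 + ‖g‖ ^ 2)) := by
        rw [sq, sq, ← mul_add]
        gcongr <;> exact norm_mul44_le _ _

/-- Serves for a summand `w` that is small in norm, with no orthogonality to `f`. -/
theorem abs_norm_add_pow_four_sub_norm_pow_le (f w : L4) {K : ℝ} (h1 : ‖f + w‖ ≤ K)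
    (h2 : ‖f‖ ≤ K) : |‖f + w‖ ^ 4 - ‖f‖ ^ 4| ≤ 4 * K ^ 3 * ‖w‖ := by
  have h3 : |‖f + w‖ - ‖f‖| ≤ ‖w‖ := by
    have := abs_norm_sub_norm_le (f + w) f
    simpa using this
  have ha := norm_nonneg (f + w)
  have hb := norm_nonneg f
  generalize ‖f + w‖ = a at *
  generalize ‖f‖ = b at *
  have hK : 0 ≤ K := hb.trans h2
  have h4 : a ^ 4 - b ^ 4 = (a ^ 3 + a ^ 2 * b + a * b ^ 2 + b ^ 3) * (a - b) := by ring
  have h5 : a ^ 3 + a ^ 2 * b + a * b ^ 2 + b ^ 3 ≤ K ^ 3 + K ^ 2 * K + K * K ^ 2 + K ^ 3 := by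
    gcongr
  rw [h4, abs_mul, abs_of_nonneg (by positivity : 0 ≤ a ^ 3 + a ^ 2 * b + a * b ^ 2 + b ^ 3)]
  calc _ ≤ (K ^ 3 + K ^ 2 * K + K * K ^ 2 + K ^ 3) * ‖w‖ := by gcongr
    _ = _ := by ring

/-! ### Asymptotic orthogonality in `L⁴`. -/

theorem exists_hasCompactSupport_norm_sub_le (f : L4) {ε : ℝ} (hε : 0 < ε) :
    ∃ (g : Space → ℂ) (hg : MemLp g 4 volume), HasCompactSupport g ∧ ‖f - hg.toLp g‖ ≤ ε := by
  obtain ⟨g, h1, h2, -, h4⟩ := (Lp.memLp f).exists_hasCompactSupport_eLpNorm_sub_le (by norm_num)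
    (ENNReal.ofReal_pos.2 hε).ne'
  refine ⟨g, h4, h1, ?_⟩
  rw [Lp.norm_def]
  apply ENNReal.toReal_le_of_le_ofReal hε.le
  refine le_of_eq_of_le (eLpNorm_congr_ae ?_) h2
  filter_upwards [Lp.coeFn_sub f (h4.toLp g), h4.coeFn_toLp] with x hx hx'
  rw [hx, Pi.sub_apply, Pi.sub_apply, hx']

/-- Both factors are approximated by compactly supported functions, whose supports become disjoint
once the translation is longer than the sum of their radii. -/
theorem tendsto_norm_mul44_shift (f g : L4) :
    Tendsto (fun a => ‖mul44 f (shift 4 a g)‖) (cocompact Space) (𝓝 0) := by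
  rw [Metric.tendsto_nhds]
  intro ε hε
  -- The quantity made small is the total error `δ‖g‖ + (‖f‖ + δ)δ` of the two replacements.
  obtain ⟨δ, hδ0, hδ⟩ : ∃ δ > 0, δ * (‖g‖ + (‖f‖ + δ)) < ε := by
    have hc : Tendsto (fun δ : ℝ => δ * (‖g‖ + (‖f‖ + δ))) (𝓝[>] 0) (𝓝 0) := by
      have : Continuous fun δ : ℝ => δ * (‖g‖ + (‖f‖ + δ)) := by fun_prop
      simpa using (this.tendsto 0).mono_left nhdsWithin_le_nhds
    obtain ⟨δ, h1, h2⟩ := ((hc.eventually (gt_mem_nhds hε)).and self_mem_nhdsWithin).exists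
    exact ⟨δ, h2, h1⟩
  obtain ⟨f', hf', hfs, hfd⟩ := exists_hasCompactSupport_norm_sub_le f hδ0
  obtain ⟨g', hg', hgs, hgd⟩ := exists_hasCompactSupport_norm_sub_le g hδ0
  obtain ⟨R, hR⟩ := hfs.isCompact.isBounded.exists_norm_le
  obtain ⟨S, hS⟩ := hgs.isCompact.isBounded.exists_norm_le
  have hlarge : ∀ᶠ a : Space in cocompact Space, R + S < ‖a‖ :=
    (tendsto_norm_cocompact_atTop (E := Space)).eventually_gt_atTop (R + S)
  filter_upwards [hlarge] with a ha
  have hzero : mul44 (hf'.toLp f') (shift 4 a (hg'.toLp g')) = 0 := by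
    apply Lp.ext
    have h := (measurePreserving_sub_right (volume : Measure Space) a).quasiMeasurePreserving.ae
      hg'.coeFn_toLp
    filter_upwards [coeFn_mul44 (hf'.toLp f') (shift 4 a (hg'.toLp g')), coeFn_shift 4 a
      (hg'.toLp g'), hf'.coeFn_toLp, h, Lp.coeFn_zero ℂ 2 (volume : Measure Space)]
      with x h1 h2 h3 h4 h5
    rw [h1, h2, h3, h4, h5]
    by_contra hne
    have hx1 : f' x ≠ 0 := fun h0 => hne (by simp [h0])
    have hx2 : g' (x - a) ≠ 0 := fun h0 => hne (by simp [h0])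
    have h6 := hR x (subset_tsupport _ hx1)
    have h7 := hS (x - a) (subset_tsupport _ hx2)
    have h8 : ‖a‖ ≤ ‖x‖ + ‖x - a‖ := by
      have := norm_sub_le x (x - a)
      simpa using this
    linarith
  have hf'n : ‖hf'.toLp f'‖ ≤ ‖f‖ + δ := by
    have := norm_sub_norm_le (hf'.toLp f') f
    rw [norm_sub_rev] at this
    linarith
  have hsplit : mul44 f (shift 4 a g) = mul44 (f - hf'.toLp f') (shift 4 a g) +
      mul44 (hf'.toLp f') (shift 4 a (g - hg'.toLp g')) := by
    have h1 := add_mul44 (f - hf'.toLp f') (hf'.toLp f') (shift 4 a g)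
    have h2 := mul44_add (hf'.toLp f') (shift 4 a (g - hg'.toLp g')) (shift 4 a (hg'.toLp g'))
    rw [sub_add_cancel] at h1
    rw [← map_add, sub_add_cancel, hzero, add_zero] at h2
    rw [h1, h2]
  rw [dist_zero_right, norm_norm, hsplit]
  calc _ ≤ ‖f - hf'.toLp f'‖ * ‖shift 4 a g‖ +
        ‖hf'.toLp f'‖ * ‖shift 4 a (g - hg'.toLp g')‖ :=
        (norm_add_le _ _).trans (add_le_add (norm_mul44_le _ _) (norm_mul44_le _ _))
    _ ≤ δ * ‖g‖ + (‖f‖ + δ) * δ := by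
        rw [norm_shift, norm_shift]
        gcongr
    _ < ε := by linarith

/-- If some compact set is visited eventually, the pushed-forward ultrafilter converges in it. This
dichotomy replaces passing to subsequences. -/
theorem ultrafilter_tendsto_cocompact_or_nhds {α X : Type*} [TopologicalSpace X]
    (𝒰 : Ultrafilter α) (t : α → X) :
    Tendsto t 𝒰 (cocompact X) ∨ ∃ a, Tendsto t 𝒰 (𝓝 a) := by
  by_cases h : ∃ s : Set X, IsCompact s ∧ ∀ᶠ n in (𝒰 : Filter α), t n ∈ s
  · obtain ⟨s, hs, hn⟩ := h
    obtain ⟨a, -, ha⟩ := hs.ultrafilter_le_nhds (𝒰.map t) (le_principal_iff.2 hn)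
    exact Or.inr ⟨a, ha⟩
  · push Not at h
    refine Or.inl ((hasBasis_cocompact.tendsto_right_iff).2 fun s hs => ?_)
    exact h s hs

/-- Two translated continuous orbits in `L⁴` that vanish at infinite time become orthogonal when
their parameters diverge from each other. -/
theorem tendsto_norm_mul44_of_diverging {U V : ℝ → L4} (hU : Continuous U) (hV : Continuous V)
    (hU0 : Tendsto U (cocompact ℝ) (𝓝 0)) (hV0 : Tendsto V (cocompact ℝ) (𝓝 0))
    {B : ℝ} (hUB : ∀ t, ‖U t‖ ≤ B) (hVB : ∀ t, ‖V t‖ ≤ B) {α : Type*} {l : Filter α}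
    {t s : α → ℝ} {x y : α → Space}
    (hdiv : Tendsto (fun n => |t n - s n| + ‖x n - y n‖) l atTop) :
    Tendsto (fun n => ‖mul44 (shift 4 (x n) (U (-t n))) (shift 4 (y n) (V (-s n)))‖) l (𝓝 0) := by
  rw [tendsto_iff_ultrafilter]
  intro 𝒰 h𝒰
  have hB : 0 ≤ B := (norm_nonneg _).trans (hUB 0)
  have hle : ∀ n, ‖mul44 (shift 4 (x n) (U (-t n))) (shift 4 (y n) (V (-s n)))‖ ≤
      ‖U (-t n)‖ * ‖V (-s n)‖ := fun n => by
    simpa using norm_mul44_le (shift 4 (x n) (U (-t n))) (shift 4 (y n) (V (-s n)))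
  rcases ultrafilter_tendsto_cocompact_or_nhds 𝒰 (fun n => -t n) with ht | ⟨t₀, ht⟩
  -- An escaping time makes one factor vanish while the other stays bounded by `B`.
  · refine squeeze_zero (fun n => norm_nonneg _)
      (fun n => (hle n).trans (mul_le_mul_of_nonneg_left (hVB _) (norm_nonneg _))) ?_
    simpa using ((hU0.comp ht).norm).mul_const B
  rcases ultrafilter_tendsto_cocompact_or_nhds 𝒰 (fun n => -s n) with hs | ⟨s₀, hs⟩
  · refine squeeze_zero (fun n => norm_nonneg _)
      (fun n => (hle n).trans (mul_le_mul_of_nonneg_right (hUB _) (norm_nonneg _))) ?_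
    simpa using ((hV0.comp hs).norm).const_mul B
  -- Both times now converge, so the divergence must come from the space shifts.
  have hxy : Tendsto (fun n => y n - x n) 𝒰 (cocompact Space) := by
    rw [← Metric.cobounded_eq_cocompact, ← tendsto_norm_atTop_iff_cobounded]
    have h1 : Tendsto (fun n => |t n - s n|) 𝒰 (𝓝 |t₀ - s₀|) := by
      refine ((ht.sub hs).abs).congr fun n => ?_
      rw [← abs_neg]
      ring_nf
    have h2 := (hdiv.mono_left h𝒰).atTop_add (h1.neg)
    refine h2.congr fun n => ?_
    rw [norm_sub_rev]
    ring
  have hUt := (hU.tendsto t₀).comp ht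
  have hVs := (hV.tendsto s₀).comp hs
  -- Freezing both times at their limits costs two errors that vanish by continuity; the frozen pair
  -- is separated by translation alone.
  have hbound : ∀ n, ‖mul44 (shift 4 (x n) (U (-t n))) (shift 4 (y n) (V (-s n)))‖ ≤
      ‖U (-t n) - U t₀‖ * B + B * ‖V (-s n) - V s₀‖ +
        ‖mul44 (U t₀) (shift 4 (y n - x n) (V s₀))‖ := fun n => by
    rw [norm_mul44_shift_shift]
    have h1 := add_mul44 (U (-t n) - U t₀) (U t₀) (shift 4 (y n - x n) (V (-s n)))
    have h2 := mul44_add (U t₀) (shift 4 (y n - x n) (V (-s n) - V s₀))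
      (shift 4 (y n - x n) (V s₀))
    rw [sub_add_cancel] at h1
    rw [← map_add, sub_add_cancel] at h2
    rw [h1, h2, ← add_assoc]
    refine (norm_add_le _ _).trans (add_le_add_left ((norm_add_le _ _).trans
      (add_le_add ((norm_mul44_le _ _).trans ?_) ((norm_mul44_le _ _).trans ?_))) _)
    · rw [norm_shift]
      exact mul_le_mul_of_nonneg_left (hVB _) (norm_nonneg _)
    · rw [norm_shift]
      exact mul_le_mul_of_nonneg_right (hUB _) (norm_nonneg _)
  refine squeeze_zero (fun n => norm_nonneg _) hbound ?_
  have e1 : Tendsto (fun n => ‖U (-t n) - U t₀‖) 𝒰 (𝓝 0) :=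
    tendsto_iff_norm_sub_tendsto_zero.1 hUt
  have e2 : Tendsto (fun n => ‖V (-s n) - V s₀‖) 𝒰 (𝓝 0) :=
    tendsto_iff_norm_sub_tendsto_zero.1 hVs
  have e3 := (tendsto_norm_mul44_shift (U t₀) (V s₀)).comp hxy
  simpa using ((e1.mul_const B).add (e2.const_mul B)).add e3

/-- By induction: the product of a new term with the earlier sum is bounded by the pairwise
products, all of which vanish in the limit. -/
theorem tendsto_norm_sum_pow_four_sub {ι α : Type*} {l : Filter α} (f : ι → α → L4) {B : ι → ℝ}
    (s : Finset ι) (hB : ∀ i ∈ s, ∀ n, ‖f i n‖ ≤ B i)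
    (hcross : ∀ i ∈ s, ∀ j ∈ s, i ≠ j → Tendsto (fun n => ‖mul44 (f i n) (f j n)‖) l (𝓝 0)) :
    Tendsto (fun n => ‖∑ i ∈ s, f i n‖ ^ 4 - ∑ i ∈ s, ‖f i n‖ ^ 4) l (𝓝 0) := by
  classical
  induction s using Finset.induction_on with
  | empty => simpa using tendsto_const_nhds
  | insert i s hi ih =>
    have ih' := ih (fun j hj => hB j (Finset.mem_insert_of_mem hj))
      (fun j hj k hk => hcross j (Finset.mem_insert_of_mem hj) k (Finset.mem_insert_of_mem hk))
    have hS : ∀ n, ‖∑ j ∈ s, f j n‖ ≤ ∑ j ∈ s, B j := fun n =>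
      norm_sum_le_of_le _ fun j hj => hB j (Finset.mem_insert_of_mem hj) n
    have hi' : ∀ n, ‖f i n‖ ≤ B i := hB i (Finset.mem_insert_self _ _)
    have hm : Tendsto (fun n => ‖mul44 (f i n) (∑ j ∈ s, f j n)‖) l (𝓝 0) := by
      have h0 : Tendsto (fun n => ∑ j ∈ s, ‖mul44 (f j n) (f i n)‖) l (𝓝 0) := by
        rw [← Finset.sum_const_zero (s := s)]
        exact tendsto_finsetSum _ fun j hj => hcross j (Finset.mem_insert_of_mem hj) i
          (Finset.mem_insert_self _ _) (fun h => hi (h ▸ hj))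
      refine squeeze_zero (fun n => norm_nonneg _) (fun n => ?_) h0
      rw [mul44_comm, sum_mul44]
      exact norm_sum_le _ _
    have hstep : Tendsto (fun n => ‖f i n + ∑ j ∈ s, f j n‖ ^ 4 - ‖f i n‖ ^ 4 -
        ‖∑ j ∈ s, f j n‖ ^ 4) l (𝓝 0) := by
      refine squeeze_zero_norm (a := fun n => 7 * (‖mul44 (f i n) (∑ j ∈ s, f j n)‖ *
        (B i ^ 2 + (∑ j ∈ s, B j) ^ 2))) (fun n => ?_) (by simpa using (hm.mul_const _).const_mul 7)
      refine (abs_L4_norm_add_pow_sub_le _ _).trans ?_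
      have := hS n
      have := hi' n
      gcongr
    have hadd := hstep.add ih'
    rw [add_zero] at hadd
    refine hadd.congr fun n => ?_
    rw [Finset.sum_insert hi, Finset.sum_insert hi]
    ring

/-! ### `H¹` and the free flow on the Fourier side. -/

theorem toTemperedDistribution_injective {f g : L2}
    (h : (f : 𝓢'(Space, ℂ)) = (g : 𝓢'(Space, ℂ))) : f = g := by
  have hker := Lp.ker_toTemperedDistributionCLM_eq_bot (F := ℂ) (μ := (volume : Measure Space))
    (p := 2)
  exact LinearMap.ker_eq_bot.1 hker h

/-- The symbol `(1 + |ξ|²)^{-1/2}`. -/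
def besselSymbol (ξ : Space) : ℂ := ((1 + ‖ξ‖ ^ 2) ^ (-1 / 2 : ℝ) : ℝ)

theorem norm_besselSymbol_sq (ξ : Space) : ‖besselSymbol ξ‖ ^ 2 = (1 + ‖ξ‖ ^ 2)⁻¹ := by
  rw [besselSymbol, Complex.norm_real, Real.norm_of_nonneg (by positivity), ← Real.rpow_natCast,
    ← Real.rpow_mul (by positivity)]
  norm_num
  rw [Real.rpow_neg_one]

theorem norm_besselSymbol_le_one (ξ : Space) : ‖besselSymbol ξ‖ ≤ 1 := by
  rw [← sq_le_one_iff₀ (norm_nonneg _), norm_besselSymbol_sq]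
  exact inv_le_one_of_one_le₀ (by nlinarith [sq_nonneg ‖ξ‖])

theorem hasTemperateGrowth_besselSymbol : besselSymbol.HasTemperateGrowth := by
  unfold besselSymbol
  fun_prop

theorem memLp_top_of_continuous_of_bound {m : Space → ℂ} (hm : Continuous m) {C : ℝ}
    (hC : ∀ ξ, ‖m ξ‖ ≤ C) : MemLp m ∞ (volume : Measure Space) :=
  memLp_top_of_bound hm.aestronglyMeasurable C (ae_of_all _ hC)

theorem memLp_besselSymbol : MemLp besselSymbol ∞ (volume : Measure Space) :=
  memLp_top_of_continuous_of_bound hasTemperateGrowth_besselSymbol.1.continuous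
    norm_besselSymbol_le_one

/-- Multiplication of an `L²` function by a bounded function. -/
def mulTop {m : Space → ℂ} (hm : MemLp m ∞ (volume : Measure Space)) (f : L2) : L2 :=
  hm.toLp • f

theorem coeFn_mulTop {m : Space → ℂ} (hm : MemLp m ∞ (volume : Measure Space)) (f : L2) :
    mulTop hm f =ᵐ[volume] fun ξ => m ξ * f ξ := by
  filter_upwards [Lp.coeFn_lpSMul (r := 2) hm.toLp f, hm.coeFn_toLp] with ξ h1 h2
  rw [mulTop, h1, Pi.smul_apply', h2, smul_eq_mul]

/-- The operator with symbol `(1 + |ξ|²)^{-1/2}`, an isomorphism of `L²` onto `H¹`. -/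
def bessel (F : L2) : L2 := 𝓕⁻ (mulTop memLp_besselSymbol (𝓕 F))

theorem fourier_bessel (F : L2) : 𝓕 (bessel F) = mulTop memLp_besselSymbol (𝓕 F) :=
  FourierTransform.fourier_fourierInv_eq _

theorem coeFn_fourier_bessel (F : L2) :
    (𝓕 (bessel F) : L2) =ᵐ[volume] fun ξ => besselSymbol ξ * (𝓕 F : L2) ξ := by
  rw [fourier_bessel]
  exact coeFn_mulTop _ _

theorem fourier_schrodinger (t : ℝ) (f : L2) :
    𝓕 (schrodinger t f) = mulTop (memLp_schrodingerSymbol t) (𝓕 f) :=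
  FourierTransform.fourier_fourierInv_eq _

theorem coeFn_fourier_schrodinger (t : ℝ) (f : L2) :
    (𝓕 (schrodinger t f) : L2) =ᵐ[volume] fun ξ => schrodingerSymbol t ξ * (𝓕 f : L2) ξ := by
  rw [fourier_schrodinger]
  exact coeFn_mulTop _ _

theorem fourier_injective {f g : L2} (h : (𝓕 f : L2) = 𝓕 g) : f = g := by
  rw [← FourierTransform.fourierInv_fourier_eq (F := L2) f, h,
    FourierTransform.fourierInv_fourier_eq (F := L2)]

theorem schrodinger_bessel (t : ℝ) (F : L2) :
    schrodinger t (bessel F) = bessel (schrodinger t F) := by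
  apply fourier_injective
  apply Lp.ext
  filter_upwards [coeFn_fourier_schrodinger t (bessel F), coeFn_fourier_bessel F,
    coeFn_fourier_bessel (schrodinger t F), coeFn_fourier_schrodinger t F] with ξ h1 h2 h3 h4
  rw [h1, h2, h3, h4]
  ring

theorem schrodinger_add (t : ℝ) (f g : L2) :
    schrodinger t (f + g) = schrodinger t f + schrodinger t g := by
  apply fourier_injective
  apply Lp.ext
  rw [FourierTransform.fourier_add]
  filter_upwards [coeFn_fourier_schrodinger t (f + g), coeFn_fourier_schrodinger t f,
    coeFn_fourier_schrodinger t g,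
    Lp.coeFn_add (𝓕 (schrodinger t f)) (𝓕 (schrodinger t g) : L2),
    Lp.coeFn_add (𝓕 f) (𝓕 g : L2)] with ξ h1 h2 h3 h4 h5
  rw [h4, h1, Pi.add_apply, h2, h3, FourierTransform.fourier_add, h5, Pi.add_apply, mul_add]

theorem norm_schrodinger (t : ℝ) (f : L2) : ‖schrodinger t f‖ = ‖f‖ := by
  rw [← Lp.norm_fourier_eq, ← Lp.norm_fourier_eq f, Lp.norm_def, Lp.norm_def]
  congr 1
  apply eLpNorm_congr_norm_ae
  filter_upwards [coeFn_fourier_schrodinger t f] with ξ h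
  rw [h, norm_mul, norm_schrodingerSymbol, one_mul]

theorem bessel_add (F G : L2) : bessel (F + G) = bessel F + bessel G := by
  apply fourier_injective
  apply Lp.ext
  rw [FourierTransform.fourier_add]
  filter_upwards [coeFn_fourier_bessel (F + G), coeFn_fourier_bessel F, coeFn_fourier_bessel G,
    Lp.coeFn_add (𝓕 (bessel F)) (𝓕 (bessel G) : L2), Lp.coeFn_add (𝓕 F) (𝓕 G : L2)]
    with ξ h1 h2 h3 h4 h5
  rw [h4, h1, Pi.add_apply, h2, h3, FourierTransform.fourier_add, h5, Pi.add_apply, mul_add]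

theorem norm_bessel_le (F : L2) : ‖bessel F‖ ≤ ‖F‖ := by
  rw [← Lp.norm_fourier_eq, ← Lp.norm_fourier_eq F]
  apply Lp.norm_le_norm_of_ae_le
  filter_upwards [coeFn_fourier_bessel F] with ξ h
  rw [h, norm_mul]
  exact mul_le_of_le_one_left (norm_nonneg _) (norm_besselSymbol_le_one ξ)

theorem bessel_neg (F : L2) : bessel (-F) = -bessel F := by
  have h0 : bessel 0 = 0 := by
    have := bessel_add 0 0
    rwa [add_zero, left_eq_add] at this
  rw [eq_neg_iff_add_eq_zero, ← bessel_add, neg_add_cancel, h0]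

theorem bessel_sub (F G : L2) : bessel (F - G) = bessel F - bessel G := by
  rw [sub_eq_add_neg, bessel_add, bessel_neg, ← sub_eq_add_neg]

theorem continuous_bessel : Continuous bessel := by
  refine LipschitzWith.continuous (K := 1) (LipschitzWith.of_dist_le_mul fun F G => ?_)
  rw [dist_eq_norm, dist_eq_norm, ← bessel_sub, NNReal.coe_one, one_mul]
  exact norm_bessel_le _

/-- The symbols `(1 + |ξ|²)^{±1/2}` are reciprocal and of temperate growth, so they cancel on
tempered distributions. Questions about `H¹` thereby become questions about `F` in `L²`. -/
theorem isH1_iff_exists_bessel {f : L2} : IsH1 f ↔ ∃ F, f = bessel F := by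
  have hg : (fun ξ : Space => (((1 + ‖ξ‖ ^ 2) ^ ((1 : ℝ) / 2) : ℝ) : ℂ)).HasTemperateGrowth := by
    fun_prop
  have hone : (besselSymbol * fun ξ : Space => (((1 + ‖ξ‖ ^ 2) ^ ((1 : ℝ) / 2) : ℝ) : ℂ)) =
      fun _ => 1 := by
    ext ξ
    rw [Pi.mul_apply, besselSymbol, ← Complex.ofReal_mul, ← Real.rpow_add (by positivity)]
    norm_num
  rw [IsH1, TemperedDistribution.memSobolev_iff_exists_smulLeftCLM_fourier]
  constructor
  · rintro ⟨G, hG⟩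
    refine ⟨𝓕⁻ G, fourier_injective ?_⟩
    rw [fourier_bessel, FourierTransform.fourier_fourierInv_eq]
    apply toTemperedDistribution_injective
    rw [mulTop, Lp.toTemperedDistribution_smul_eq hasTemperateGrowth_besselSymbol, ← hG,
      TemperedDistribution.smulLeftCLM_smulLeftCLM_apply hg hasTemperateGrowth_besselSymbol]
    rw [mul_comm, hone, TemperedDistribution.smulLeftCLM_const, one_smul,
      Lp.fourier_toTemperedDistribution_eq]
  · rintro ⟨F, rfl⟩
    refine ⟨𝓕 F, ?_⟩
    rw [Lp.fourier_toTemperedDistribution_eq, fourier_bessel, mulTop,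
      Lp.toTemperedDistribution_smul_eq hasTemperateGrowth_besselSymbol,
      TemperedDistribution.smulLeftCLM_smulLeftCLM_apply hasTemperateGrowth_besselSymbol hg]
    rw [hone, TemperedDistribution.smulLeftCLM_const, one_smul]

theorem IsH1.schrodinger {f : L2} (hf : IsH1 f) (t : ℝ) : IsH1 (schrodinger t f) := by
  obtain ⟨F, rfl⟩ := isH1_iff_exists_bessel.1 hf
  exact isH1_iff_exists_bessel.2 ⟨_, schrodinger_bessel t F⟩

theorem homSobolevSq_schrodinger (s t : ℝ) (f : L2) :
    homSobolevSq s (NLS.schrodinger t f) = homSobolevSq s f := by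
  apply integral_congr_ae
  filter_upwards [coeFn_fourier_schrodinger t f] with ξ h
  rw [h, norm_mul, norm_schrodingerSymbol, one_mul]

/-- The multiplier `ξ i` is unbounded, but its product with `besselSymbol` is bounded by `1`.
Writing `f = bessel F` thus turns an identity of distributions into one in `L²`. -/
theorem IsWeakPartial.coeFn_fourier {i : Fin 3} {f g : L2} (h : IsWeakPartial i f g)
    (hf : IsH1 f) :
    (𝓕 g : L2) =ᵐ[volume] fun ξ => (2 * Real.pi * Complex.I) * ((ξ i : ℝ) : ℂ) * (𝓕 f : L2) ξ := by
  obtain ⟨F, rfl⟩ := isH1_iff_exists_bessel.1 hf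
  set e : Space := EuclideanSpace.single i (1 : ℝ) with he
  have hin : (fun ξ : Space => ((inner ℝ ξ e : ℝ) : ℂ)).HasTemperateGrowth := by fun_prop
  have hgrow : (besselSymbol * fun ξ : Space => ((inner ℝ ξ e : ℝ) : ℂ)).HasTemperateGrowth :=
    hasTemperateGrowth_besselSymbol.mul hin
  have hbound : ∀ ξ, ‖(besselSymbol * fun ξ : Space => ((inner ℝ ξ e : ℝ) : ℂ)) ξ‖ ≤ 1 := by
    intro ξ
    rw [← sq_le_one_iff₀ (norm_nonneg _), Pi.mul_apply, norm_mul, mul_pow, norm_besselSymbol_sq,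
      inv_mul_le_iff₀ (by positivity), mul_one, Complex.norm_real]
    have h1 : ‖(inner ℝ ξ e : ℝ)‖ ≤ ‖ξ‖ := by
      have := norm_inner_le_norm (𝕜 := ℝ) ξ e
      rwa [he, PiLp.norm_single, norm_one, mul_one] at this
    have h2 : ‖(inner ℝ ξ e : ℝ)‖ ^ 2 ≤ ‖ξ‖ ^ 2 := by gcongr
    linarith
  have hmem := memLp_top_of_continuous_of_bound hgrow.1.continuous hbound
  have key : 𝓕 g = (2 * Real.pi * Complex.I) • mulTop hmem (𝓕 F) := by
    apply toTemperedDistribution_injective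
    rw [← Lp.fourier_toTemperedDistribution_eq, ← h,
      TemperedDistribution.fourier_lineDerivOp_eq, Lp.fourier_toTemperedDistribution_eq,
      fourier_bessel]
    simp only [mulTop]
    rw [Lp.toTemperedDistribution_smul_eq hasTemperateGrowth_besselSymbol,
      TemperedDistribution.smulLeftCLM_smulLeftCLM_apply hasTemperateGrowth_besselSymbol hin,
      ← Lp.toTemperedDistribution_smul_eq (q := 2) (r := 2) hgrow hmem]
    exact (map_smul (Lp.toTemperedDistributionCLM ℂ (volume : Measure Space) 2) _ _).symm
  rw [key]
  filter_upwards [Lp.coeFn_smul (2 * Real.pi * Complex.I) (mulTop hmem (𝓕 F)),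
    coeFn_mulTop hmem (𝓕 F), coeFn_fourier_bessel F] with ξ h1 h2 h3
  rw [h1, Pi.smul_apply, h2, h3, Pi.mul_apply, he, EuclideanSpace.inner_single_right]
  simp only [smul_eq_mul, one_mul, conj_trivial]
  ring

theorem integrable_weight_mul_sq_fourier {f : L2} (hf : IsH1 f) :
    Integrable (fun ξ => (1 + ‖ξ‖ ^ 2) * ‖(𝓕 f : L2) ξ‖ ^ 2) := by
  obtain ⟨F, rfl⟩ := isH1_iff_exists_bessel.1 hf
  refine (integrable_L2_sq (𝓕 F)).congr ?_
  filter_upwards [coeFn_fourier_bessel F] with ξ h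
  rw [h, norm_mul, mul_pow, norm_besselSymbol_sq]
  field_simp

theorem norm_sq_eq_integral_weight_mul_sq_fourier (F : L2) :
    ‖F‖ ^ 2 = ∫ ξ, (1 + ‖ξ‖ ^ 2) * ‖(𝓕 (bessel F) : L2) ξ‖ ^ 2 := by
  rw [← Lp.norm_fourier_eq, L2_norm_sq]
  apply integral_congr_ae
  filter_upwards [coeFn_fourier_bessel F] with ξ h
  rw [h, norm_mul, mul_pow, norm_besselSymbol_sq]
  field_simp

theorem homSobolevSq_one (f : L2) :
    homSobolevSq 1 f = ∫ ξ, (2 * Real.pi) ^ 2 * (‖ξ‖ ^ 2 * ‖(𝓕 f : L2) ξ‖ ^ 2) := by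
  apply integral_congr_ae (ae_of_all _ fun ξ => ?_)
  simp only [mul_one, Real.rpow_ofNat]
  ring

theorem homSobolevSq_zero (f : L2) : homSobolevSq 0 f = ‖f‖ ^ 2 := by
  rw [← Lp.norm_fourier_eq, L2_norm_sq]
  apply integral_congr_ae (ae_of_all _ fun ξ => ?_)
  simp

theorem integrable_norm_sq_mul_sq_fourier {f : L2} (hf : IsH1 f) :
    Integrable (fun ξ => ‖ξ‖ ^ 2 * ‖(𝓕 f : L2) ξ‖ ^ 2) := by
  refine ((integrable_weight_mul_sq_fourier hf).sub (integrable_L2_sq (𝓕 f))).congr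
    (ae_of_all _ fun ξ => ?_)
  simp only [Pi.sub_apply]
  ring

/-- The factor `(2π)⁻²` reconciles `|ξ|` in `besselSymbol` with `2π|ξ|` in `homSobolevSq`. -/
theorem norm_sq_of_bessel (F : L2) :
    ‖F‖ ^ 2 = homSobolevSq 0 (bessel F) + (2 * Real.pi)⁻¹ ^ 2 * homSobolevSq 1 (bessel F) := by
  have hf : IsH1 (bessel F) := isH1_iff_exists_bessel.2 ⟨F, rfl⟩
  rw [norm_sq_eq_integral_weight_mul_sq_fourier, homSobolevSq_zero, ← Lp.norm_fourier_eq,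
    L2_norm_sq, homSobolevSq_one, integral_const_mul, ← mul_assoc, ← mul_pow,
    inv_mul_cancel₀ (by positivity), one_pow, one_mul,
    ← integral_add (integrable_L2_sq _) (integrable_norm_sq_mul_sq_fourier hf)]
  simp only [add_mul, one_mul]

theorem sum_norm_sq_of_isWeakPartial {f : L2} (hf : IsH1 f) {g : Fin 3 → L2}
    (hg : ∀ i, IsWeakPartial i f (g i)) : ∑ i, ‖g i‖ ^ 2 = homSobolevSq 1 f := by
  have h : ∀ i, ‖g i‖ ^ 2 = ∫ ξ : Space, ‖(𝓕 (g i) : L2) ξ‖ ^ 2 := fun i => by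
    rw [← Lp.norm_fourier_eq, L2_norm_sq]
  rw [homSobolevSq_one, Finset.sum_congr rfl fun i _ => h i,
    ← integral_finsetSum _ fun i _ => integrable_L2_sq _]
  apply integral_congr_ae
  filter_upwards [ae_all_iff.2 fun i => (hg i).coeFn_fourier hf] with ξ hξ
  simp only [hξ, norm_mul, mul_pow, EuclideanSpace.norm_sq_eq, Finset.sum_mul, Finset.mul_sum]
  refine Finset.sum_congr rfl fun i _ => ?_
  simp
  ring

/-- Connects the kinetic energy, given by weak derivatives, with the Fourier-side norm of the
Pythagorean hypothesis. -/
theorem integral_gradSq {f : L2} (hf : IsH1 f) : ∫ x, gradSq f x = homSobolevSq 1 f := by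
  rw [← sum_norm_sq_of_isWeakPartial hf hf.isWeakPartial]
  simp only [gradSq, L2_norm_sq]
  exact integral_finsetSum _ fun i _ => integrable_L2_sq _

/-- Plancherel and dominated convergence: two unimodular symbols differ by at most `2`. -/
theorem continuous_schrodinger (f : L2) : Continuous fun t => schrodinger t f := by
  rw [continuous_iff_continuousAt]
  intro t₀
  rw [ContinuousAt, tendsto_iff_norm_sub_tendsto_zero]
  have hsq : ∀ t, ‖schrodinger t f - schrodinger t₀ f‖ ^ 2 =
      ∫ ξ, (‖schrodingerSymbol t ξ - schrodingerSymbol t₀ ξ‖ * ‖(𝓕 f : L2) ξ‖) ^ 2 := fun t => by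
    have hF : (𝓕 (schrodinger t f - schrodinger t₀ f) : L2) =
        𝓕 (schrodinger t f) - 𝓕 (schrodinger t₀ f) := map_sub (Lp.fourierTransformₗᵢ Space ℂ) _ _
    rw [← Lp.norm_fourier_eq, hF, L2_norm_sq]
    apply integral_congr_ae
    filter_upwards [Lp.coeFn_sub (𝓕 (schrodinger t f) : L2) (𝓕 (schrodinger t₀ f)),
      coeFn_fourier_schrodinger t f, coeFn_fourier_schrodinger t₀ f] with ξ h1 h2 h3
    rw [h1, Pi.sub_apply, h2, h3, ← sub_mul, norm_mul]
  have hlim : Tendsto (fun t => ‖schrodinger t f - schrodinger t₀ f‖ ^ 2) (𝓝 t₀) (𝓝 0) := by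
    simp only [hsq]
    have hzero : (0 : ℝ) = ∫ ξ, (‖schrodingerSymbol t₀ ξ - schrodingerSymbol t₀ ξ‖ *
        ‖(𝓕 f : L2) ξ‖) ^ 2 := by simp
    rw [hzero]
    refine tendsto_integral_filter_of_dominated_convergence
      (fun ξ => (2 * ‖(𝓕 f : L2) ξ‖) ^ 2) ?_ ?_ ?_ ?_
    · refine Eventually.of_forall fun t => ?_
      have h1 : AEStronglyMeasurable (schrodingerSymbol t) (volume : Measure Space) :=
        (memLp_schrodingerSymbol t).1
      have h2 := (memLp_schrodingerSymbol t₀).1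
      exact (((h1.sub h2).norm).mul (Lp.aestronglyMeasurable _).norm).pow 2
    · refine Eventually.of_forall fun t => ae_of_all _ fun ξ => ?_
      rw [Real.norm_of_nonneg (by positivity)]
      gcongr
      refine (norm_sub_le _ _).trans ?_
      rw [norm_schrodingerSymbol, norm_schrodingerSymbol]
      norm_num
    · simp only [mul_pow]
      exact (integrable_L2_sq _).const_mul _
    · refine ae_of_all _ fun ξ => ?_
      have : Continuous fun t =>
          (‖schrodingerSymbol t ξ - schrodingerSymbol t₀ ξ‖ * ‖(𝓕 f : L2) ξ‖) ^ 2 := by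
        unfold schrodingerSymbol
        fun_prop
      exact this.tendsto t₀
  have hsqrt := hlim.sqrt
  simpa [Real.sqrt_sq (norm_nonneg _)] using hsqrt

/-! ### Sobolev embeddings into `L⁶` and `L⁴`. -/

open scoped NNReal in
/-- The Gagliardo-Nirenberg-Sobolev inequality for functions without compact support. -/
theorem exists_eLpNorm_six_le : ∃ C : ℝ≥0, ∀ u : Space → ℂ, ContDiff ℝ 1 u →
    eLpNorm u 6 volume ≤ C * (eLpNorm (fderiv ℝ u) 2 volume + eLpNorm u 2 volume) := by
  -- The compactly supported inequality is applied to `χ(x/(n+1)) u(x)`. The cutoffs have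
  -- derivatives bounded by `K` for all `n`, and the `L⁶` norm is lower semicontinuous along their
  -- pointwise limit `u`.
  let χ : ContDiffBump (0 : Space) := ⟨1, 2, one_pos, one_lt_two⟩
  have hχ : ContDiff ℝ 1 χ := χ.contDiff
  obtain ⟨K, hK⟩ := (hχ.continuous_fderiv one_ne_zero).bounded_above_of_compact_support
    (χ.hasCompactSupport.fderiv (𝕜 := ℝ))
  have hK0 : 0 ≤ K := (norm_nonneg _).trans (hK 0)
  let A : ℝ≥0 := SNormLESNormFDerivOfEqConst ℂ (volume : Measure Space) 2
  refine ⟨A * (1 + K.toNNReal), fun u hu => ?_⟩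
  let v : ℕ → Space → ℂ := fun n x => χ ((n + 1 : ℝ)⁻¹ • x) • u x
  have hc : ∀ n : ℕ, (0 : ℝ) < (n + 1 : ℝ)⁻¹ := fun n => by positivity
  have hc1 : ∀ n : ℕ, (n + 1 : ℝ)⁻¹ ≤ 1 := fun n =>
    inv_le_one_of_one_le₀ (by linarith [(Nat.cast_nonneg n : (0 : ℝ) ≤ n)])
  have hχn : ∀ n : ℕ, ContDiff ℝ 1 fun x : Space => χ ((n + 1 : ℝ)⁻¹ • x) := fun n =>
    hχ.comp (contDiff_const_smul _)
  have hv : ∀ n, ContDiff ℝ 1 (v n) := fun n => (hχn n).smul hu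
  have hvs : ∀ n, HasCompactSupport (v n) := fun n =>
    (χ.hasCompactSupport.comp_smul (hc n).ne').smul_right
  have hfd : ∀ n x, ‖fderiv ℝ (v n) x‖ ≤ ‖fderiv ℝ u x‖ + K * ‖u x‖ := by
    intro n x
    have h1 : HasFDerivAt (fun x : Space => χ ((n + 1 : ℝ)⁻¹ • x))
        ((fderiv ℝ χ ((n + 1 : ℝ)⁻¹ • x)).comp ((n + 1 : ℝ)⁻¹ • ContinuousLinearMap.id ℝ Space))
        x :=
      ((hχ.differentiable one_ne_zero _).hasFDerivAt).comp x
        ((hasFDerivAt_id x).const_smul ((n + 1 : ℝ)⁻¹))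
    have h2 := h1.smul ((hu.differentiable one_ne_zero x).hasFDerivAt)
    rw [show fderiv ℝ (v n) x = _ from h2.fderiv]
    refine (norm_add_le _ _).trans (add_le_add ?_ ?_)
    · rw [norm_smul, Real.norm_of_nonneg χ.nonneg]
      exact mul_le_of_le_one_left (norm_nonneg _) χ.le_one
    · rw [ContinuousLinearMap.norm_smulRight_apply]
      refine mul_le_mul_of_nonneg_right ?_ (norm_nonneg _)
      refine (ContinuousLinearMap.opNorm_comp_le _ _).trans ?_
      calc _ ≤ K * 1 := by
            refine mul_le_mul (hK _) ?_ (norm_nonneg _) hK0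
            rw [norm_smul, Real.norm_of_nonneg (hc n).le]
            exact mul_le_one₀ (hc1 n) (norm_nonneg _) ContinuousLinearMap.norm_id_le
        _ = K := mul_one K
  have hmeas_fd : AEStronglyMeasurable (fderiv ℝ u) (volume : Measure Space) :=
    (hu.continuous_fderiv one_ne_zero).aestronglyMeasurable
  have hmeas_u : AEStronglyMeasurable u (volume : Measure Space) :=
    hu.continuous.aestronglyMeasurable
  have hbound : ∀ n, eLpNorm (v n) 6 volume ≤
      (A * (1 + K.toNNReal) : ℝ≥0) * (eLpNorm (fderiv ℝ u) 2 volume + eLpNorm u 2 volume) := by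
    intro n
    have hfin : Module.finrank ℝ Space = 3 := by simp
    have h1 := eLpNorm_le_eLpNorm_fderiv_of_eq (volume : Measure Space) (hv n) (hvs n) (p := 2)
      (p' := 6) (by norm_num) (by rw [hfin]; norm_num) (by rw [hfin]; norm_num)
    have h2 : eLpNorm (fderiv ℝ (v n)) 2 volume ≤
        eLpNorm (fderiv ℝ u) 2 volume + K.toNNReal * eLpNorm u 2 volume := by
      calc eLpNorm (fderiv ℝ (v n)) 2 volume
          ≤ eLpNorm (fun x => ‖fderiv ℝ u x‖ + K * ‖u x‖) 2 volume := by
            refine eLpNorm_mono_real fun x => hfd n x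
        _ ≤ eLpNorm (fun x => ‖fderiv ℝ u x‖) 2 volume +
            eLpNorm (fun x => K * ‖u x‖) 2 volume :=
            eLpNorm_add_le hmeas_fd.norm (hmeas_u.norm.const_mul K) (by norm_num)
        _ = eLpNorm (fderiv ℝ u) 2 volume + K.toNNReal * eLpNorm u 2 volume := by
            have h3 := eLpNorm_const_smul (μ := (volume : Measure Space)) K
              (fun x => ‖u x‖) 2
            rw [eLpNorm_norm] at h3 ⊢
            rw [← show ‖K‖ₑ = (K.toNNReal : ℝ≥0∞) from Real.enorm_of_nonneg hK0, ← h3]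
            rfl
    calc eLpNorm (v n) 6 volume ≤ A * eLpNorm (fderiv ℝ (v n)) 2 volume := h1
      _ ≤ A * (eLpNorm (fderiv ℝ u) 2 volume + K.toNNReal * eLpNorm u 2 volume) := by gcongr
      _ ≤ A * ((1 + K.toNNReal) * (eLpNorm (fderiv ℝ u) 2 volume + eLpNorm u 2 volume)) := by
          gcongr
          rw [mul_add]
          gcongr
          · exact le_mul_of_one_le_left' le_self_add
          · exact le_add_self
      _ = _ := by push_cast; rw [mul_assoc]
  refine Lp.eLpNorm_le_of_ae_tendsto (f := v) (u := atTop) (Eventually.of_forall hbound)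
    (fun n => (hv n).continuous.aestronglyMeasurable) (ae_of_all _ fun x => ?_)
  have h0 : Tendsto (fun n : ℕ => ((n + 1 : ℝ)⁻¹) • x) atTop (𝓝 0) := by
    have := (tendsto_one_div_add_atTop_nhds_zero_nat (𝕜 := ℝ)).smul_const x
    simpa using this
  have h1 := ((χ.continuous.tendsto 0).comp h0).smul_const (u x)
  rwa [χ.one_of_mem_closedBall (Metric.mem_closedBall_self χ.rIn_pos.le), one_smul] at h1

/-- The Fourier multiplier with symbol `(1 + |ξ|²)^{-1/2}` on Schwartz functions. -/
def besselSchwartz (h : 𝓢(Space, ℂ)) : 𝓢(Space, ℂ) :=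
  𝓕⁻ (SchwartzMap.smulLeftCLM ℂ besselSymbol (𝓕 h))

/-- Schwartz functions stay Schwartz under a symbol of temperate growth, so on a dense class `bessel
F` has classical derivatives. -/
theorem bessel_toLp (h : 𝓢(Space, ℂ)) : bessel (h.toLp 2) = (besselSchwartz h).toLp 2 := by
  rw [bessel, besselSchwartz, ← SchwartzMap.toLp_fourierInv_eq, SchwartzMap.toLp_fourier_eq]
  congr 1
  apply Lp.ext
  filter_upwards [coeFn_mulTop memLp_besselSymbol ((𝓕 h).toLp 2), (𝓕 h).coeFn_toLp 2,
    (SchwartzMap.smulLeftCLM ℂ besselSymbol (𝓕 h)).coeFn_toLp 2] with ξ h1 h2 h3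
  rw [h1, h2, h3, SchwartzMap.smulLeftCLM_apply_apply hasTemperateGrowth_besselSymbol,
    smul_eq_mul]

theorem isWeakPartial_toLp (u : 𝓢(Space, ℂ)) (i : Fin 3) :
    IsWeakPartial i (u.toLp 2)
      ((∂_{(EuclideanSpace.single i (1 : ℝ) : Space)} u : 𝓢(Space, ℂ)).toLp 2) := by
  rw [IsWeakPartial, Lp.toTemperedDistribution_toLp_eq, Lp.toTemperedDistribution_toLp_eq,
    TemperedDistribution.lineDerivOp_toTemperedDistributionCLM_eq]

theorem norm_fderiv_le_sum (u : 𝓢(Space, ℂ)) (x : Space) :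
    ‖fderiv ℝ u x‖ ≤
      ∑ i, ‖(∂_{(EuclideanSpace.single i (1 : ℝ) : Space)} u : 𝓢(Space, ℂ)) x‖ := by
  refine ContinuousLinearMap.opNorm_le_bound _ (by positivity) fun v => ?_
  have hv : v = ∑ i, v i • (EuclideanSpace.single i (1 : ℝ) : Space) := by
    ext j
    simp [Finset.sum_apply, Pi.single_apply]
  conv_lhs => rw [hv, map_sum]
  rw [Finset.sum_mul]
  refine norm_sum_le_of_le _ fun i _ => ?_
  rw [map_smul, norm_smul, mul_comm, SchwartzMap.lineDerivOp_apply_eq_fderiv]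
  gcongr
  exact PiLp.norm_apply_le v i

theorem homSobolevSq_one_bessel_le (F : L2) :
    homSobolevSq 1 (bessel F) ≤ (2 * Real.pi * ‖F‖) ^ 2 := by
  have h := norm_sq_of_bessel F
  rw [homSobolevSq_zero] at h
  have h0 := sq_nonneg ‖bessel F‖
  rw [mul_pow, h, mul_add, ← mul_assoc _ ((2 * Real.pi)⁻¹ ^ 2),
    ← mul_pow (2 * Real.pi) (2 * Real.pi)⁻¹,
    mul_inv_cancel₀ (by positivity), one_pow, one_mul]
  have : 0 ≤ (2 * Real.pi) ^ 2 * ‖bessel F‖ ^ 2 := by positivity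
  linarith

/-- Weak derivatives are unique in `L²`, so any candidate `g` is one of the three terms summing to
the squared `Ḣ¹` norm. -/
theorem norm_le_of_isWeakPartial_bessel {F g : L2} {i : Fin 3}
    (h : IsWeakPartial i (bessel F) g) : ‖g‖ ≤ 2 * Real.pi * ‖F‖ := by
  have hf : IsH1 (bessel F) := isH1_iff_exists_bessel.2 ⟨F, rfl⟩
  have hg : g = weakPartial i (bessel F) :=
    toTemperedDistribution_injective (h.symm.trans (hf.isWeakPartial i))
  have hsum := sum_norm_sq_of_isWeakPartial hf hf.isWeakPartial
  refine le_of_sq_le_sq ?_ (by positivity)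
  refine le_trans ?_ (hsum.le.trans (homSobolevSq_one_bessel_le F))
  rw [hg]
  exact Finset.single_le_sum (f := fun i => ‖weakPartial i (bessel F)‖ ^ 2)
    (fun i _ => sq_nonneg _) (Finset.mem_univ i)

/-- The partial derivative of a Schwartz function. -/
def partialSchwartz (i : Fin 3) (u : 𝓢(Space, ℂ)) : 𝓢(Space, ℂ) :=
  ∂_{(EuclideanSpace.single i (1 : ℝ) : Space)} u

theorem eLpNorm_fderiv_le_sum (u : 𝓢(Space, ℂ)) :
    eLpNorm (fderiv ℝ u) 2 volume ≤ ∑ i, eLpNorm (partialSchwartz i u) 2 volume := by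
  refine (eLpNorm_mono_real (norm_fderiv_le_sum u)).trans ?_
  have h1 := eLpNorm_sum_le (μ := (volume : Measure Space)) (p := 2) (s := Finset.univ)
    (f := fun (i : Fin 3) x => ‖partialSchwartz i u x‖)
    (fun i _ => (SchwartzMap.continuous _).norm.aestronglyMeasurable) (by norm_num)
  simp only [eLpNorm_norm] at h1
  refine le_trans (le_of_eq ?_) h1
  congr 1

theorem eLpNorm_partialSchwartz_le {u : 𝓢(Space, ℂ)} {F : L2} (h : bessel F = u.toLp 2 volume)
    (i : Fin 3) :
    eLpNorm (partialSchwartz i u) 2 volume ≤ ENNReal.ofReal (2 * Real.pi) * ‖F‖ₑ := by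
  have hw : IsWeakPartial i (bessel F) ((partialSchwartz i u).toLp 2 volume) := by
    rw [h]
    exact isWeakPartial_toLp u i
  rw [← eLpNorm_congr_ae ((partialSchwartz i u).coeFn_toLp 2 volume), ← Lp.enorm_def,
    ← ofReal_norm, ← ofReal_norm, ← ENNReal.ofReal_mul (by positivity)]
  exact ENNReal.ofReal_le_ofReal (norm_le_of_isWeakPartial_bessel hw)

open scoped NNReal in
theorem eLpNorm_six_bessel_toLp_le {C : ℝ≥0} (hC : ∀ u : Space → ℂ, ContDiff ℝ 1 u →
    eLpNorm u 6 volume ≤ C * (eLpNorm (fderiv ℝ u) 2 volume + eLpNorm u 2 volume))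
    (h : 𝓢(Space, ℂ)) : eLpNorm (bessel (h.toLp 2 volume)) 6 volume ≤
      (C * (3 * (2 * Real.pi).toNNReal + 1) : ℝ≥0) * ‖(h.toLp 2 volume : L2)‖ₑ := by
  have hbu := bessel_toLp h
  generalize (h.toLp 2 volume : L2) = F at *
  generalize besselSchwartz h = u at *
  -- Three partial derivatives, each at most `2π‖F‖`; the `+ 1` in the constant pays for the `L²`
  -- norm of `u`.
  have hfd : eLpNorm (fderiv ℝ u) 2 volume ≤ 3 * (ENNReal.ofReal (2 * Real.pi) * ‖F‖ₑ) := by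
    refine (eLpNorm_fderiv_le_sum u).trans
      ((Finset.sum_le_sum fun i _ => eLpNorm_partialSchwartz_le hbu i).trans ?_)
    simp
  have hu2 : eLpNorm u 2 volume ≤ ‖F‖ₑ := by
    rw [← eLpNorm_congr_ae (u.coeFn_toLp 2 volume), ← hbu, ← Lp.enorm_def, ← ofReal_norm,
      ← ofReal_norm]
    exact ENNReal.ofReal_le_ofReal (norm_bessel_le F)
  rw [hbu, eLpNorm_congr_ae (u.coeFn_toLp 2 volume)]
  calc eLpNorm u 6 volume ≤ C * (eLpNorm (fderiv ℝ u) 2 volume + eLpNorm u 2 volume) :=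
        hC u (u.smooth 1)
    _ ≤ C * (3 * (ENNReal.ofReal (2 * Real.pi) * ‖F‖ₑ) + ‖F‖ₑ) := by gcongr
    _ = _ := by
        rw [ENNReal.ofReal]
        push_cast
        ring

open scoped NNReal in
/-- The Sobolev embedding `H¹ ⊂ L⁶`. -/
theorem exists_eLpNorm_six_bessel_le :
    ∃ C : ℝ≥0, ∀ F : L2, eLpNorm (bessel F) 6 volume ≤ C * ‖F‖ₑ := by
  obtain ⟨C, hC⟩ := exists_eLpNorm_six_le
  refine ⟨C * (3 * (2 * Real.pi).toNNReal + 1), fun F => ?_⟩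
  have hS := eLpNorm_six_bessel_toLp_le hC
  generalize C * (3 * (2 * Real.pi).toNNReal + 1) = C' at *
  obtain ⟨a, ha, hlim⟩ := mem_closure_iff_seq_limit.1
    ((SchwartzMap.denseRange_toLpCLM (E := Space) (F := ℂ) (μ := volume) (p := 2)
      ENNReal.ofNat_ne_top) F)
  have hbl := (continuous_bessel.tendsto F).comp hlim
  have hlim' : Tendsto (fun n => (C' : ℝ≥0∞) * ‖a n‖ₑ) atTop (𝓝 (C' * ‖F‖ₑ)) :=
    ENNReal.Tendsto.const_mul (hlim.enorm) (Or.inr ENNReal.coe_ne_top)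
  -- Any `K` above the target bounds the approximants eventually. Their `L²` limit is a limit in
  -- measure, under which the `L⁶` norm is lower semicontinuous.
  refine le_of_forall_gt_imp_ge_of_dense fun K hK => ?_
  refine eLpNorm_le_of_tendstoInMeasure ?_ (tendstoInMeasure_of_tendsto_Lp hbl)
    fun n => Lp.aestronglyMeasurable _
  filter_upwards [hlim'.eventually (gt_mem_nhds hK)] with n hn
  obtain ⟨h, hh⟩ := ha n
  refine le_trans ?_ hn.le
  have := hS h
  have e : (h.toLp 2 volume : L2) = a n := hh
  rw [e] at this
  exact this

/-- Hölder applied to `|f| · |f|`; every interpolation inequality below is an instance. -/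
theorem eLpNorm_sq_le_mul {p q r : ℝ≥0∞} [ENNReal.HolderTriple p q r] {f : Space → ℂ}
    (hf : AEStronglyMeasurable f volume) :
    eLpNorm f (r * 2) volume ^ 2 ≤ eLpNorm f p volume * eLpNorm f q volume := by
  have h := eLpNorm_smul_le_mul_eLpNorm (p := p) (q := q) (r := r) hf hf
  refine le_trans (le_of_eq ?_) h
  have h2 := eLpNorm_norm_rpow (μ := (volume : Measure Space)) (p := r) f (q := 2) two_pos
  rw [ENNReal.ofReal_ofNat, ENNReal.rpow_ofNat] at h2
  rw [← h2]
  refine eLpNorm_congr_norm_ae (ae_of_all _ fun x => ?_)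
  simp [sq]

instance holderTriple_three_six_two : ENNReal.HolderTriple 3 6 2 where
  inv_add_inv_eq_inv := by
    rw [← ENNReal.toReal_eq_toReal_iff' (by simp) (by simp),
      ENNReal.toReal_add (by simp) (by simp)]
    norm_num

instance holderTriple_two_six_three_halves : ENNReal.HolderTriple 2 6 (3 / 2) where
  inv_add_inv_eq_inv := by
    rw [← ENNReal.toReal_eq_toReal_iff' (by simp)
      (ENNReal.inv_ne_top.2 (ENNReal.div_pos (by simp) (by simp)).ne'),
      ENNReal.toReal_add (by simp) (by simp), ENNReal.toReal_inv (3 / 2), ENNReal.toReal_div]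
    norm_num

theorem eLpNorm_four_sq_le_three_six {f : Space → ℂ} (hf : AEStronglyMeasurable f volume) :
    eLpNorm f 4 volume ^ 2 ≤ eLpNorm f 3 volume * eLpNorm f 6 volume := by
  have h := eLpNorm_sq_le_mul (p := 3) (q := 6) (r := 2) hf
  rwa [show (2 * 2 : ℝ≥0∞) = 4 by norm_num] at h

theorem eLpNorm_three_sq_le_two_six {f : Space → ℂ} (hf : AEStronglyMeasurable f volume) :
    eLpNorm f 3 volume ^ 2 ≤ eLpNorm f 2 volume * eLpNorm f 6 volume := by
  have h := eLpNorm_sq_le_mul (p := 2) (q := 6) (r := 3 / 2) hf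
  rwa [ENNReal.div_mul_cancel (by simp) (by simp)] at h

theorem eLpNorm_four_sq_le_top_two {f : Space → ℂ} (hf : AEStronglyMeasurable f volume) :
    eLpNorm f 4 volume ^ 2 ≤ eLpNorm f ∞ volume * eLpNorm f 2 volume := by
  have h := eLpNorm_sq_le_mul (p := ∞) (q := 2) (r := 2) hf
  rwa [show (2 * 2 : ℝ≥0∞) = 4 by norm_num] at h

open scoped NNReal in
/-- The Sobolev embedding `H¹ ⊂ L⁴`. -/
theorem exists_eLpNorm_four_bessel_le :
    ∃ C : ℝ≥0, ∀ F : L2, eLpNorm (bessel F) 4 volume ≤ C * ‖F‖ₑ := by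
  obtain ⟨C, hC⟩ := exists_eLpNorm_six_bessel_le
  refine ⟨C + 1, fun F => ?_⟩
  have h2 : eLpNorm (bessel F) 2 volume ≤ ‖F‖ₑ := by
    rw [← Lp.enorm_def, ← ofReal_norm, ← ofReal_norm]
    exact ENNReal.ofReal_le_ofReal (norm_bessel_le F)
  have hm := Lp.aestronglyMeasurable (bessel F)
  have hC1 : (C : ℝ≥0∞) ≤ (C + 1 : ℝ≥0) := by
    push_cast
    exact le_self_add
  -- Two interpolations give `‖f‖₄⁴ ≤ ‖f‖₃²‖f‖₆² ≤ ‖f‖₂‖f‖₆³`; the constant `C + 1` dominates both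
  -- `1` and `C`.
  rw [← ENNReal.pow_le_pow_left_iff (n := 4) (by norm_num)]
  calc eLpNorm (bessel F) 4 volume ^ 4 = (eLpNorm (bessel F) 4 volume ^ 2) ^ 2 := by ring
    _ ≤ (eLpNorm (bessel F) 3 volume * eLpNorm (bessel F) 6 volume) ^ 2 := by
        gcongr
        exact eLpNorm_four_sq_le_three_six hm
    _ = eLpNorm (bessel F) 3 volume ^ 2 * eLpNorm (bessel F) 6 volume ^ 2 := by ring
    _ ≤ (eLpNorm (bessel F) 2 volume * eLpNorm (bessel F) 6 volume) *
          eLpNorm (bessel F) 6 volume ^ 2 := by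
        gcongr
        exact eLpNorm_three_sq_le_two_six hm
    _ ≤ (‖F‖ₑ * (C * ‖F‖ₑ)) * (C * ‖F‖ₑ) ^ 2 := by
        gcongr <;> exact hC F
    _ ≤ (((C + 1 : ℝ≥0) * ‖F‖ₑ) * ((C + 1 : ℝ≥0) * ‖F‖ₑ)) * ((C + 1 : ℝ≥0) * ‖F‖ₑ) ^ 2 := by
        gcongr
        · refine le_mul_of_one_le_left' ?_
          push_cast
          exact le_add_self
    _ = _ := by ring

/-! ### Passage from `L²` to `L⁴`. -/

open Classical in
/-- An `L²` function as an element of `L⁴`, where it belongs to `L⁴`, and `0` elsewhere. -/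
def toL4 (f : L2) : L4 := if h : MemLp f 4 volume then h.toLp f else 0

theorem coeFn_toL4 {f : L2} (h : MemLp f 4 volume) : toL4 f =ᵐ[volume] f := by
  rw [toL4, dif_pos h]
  exact h.coeFn_toLp

theorem memLp_four_bessel (F : L2) : MemLp (bessel F) 4 volume := by
  obtain ⟨C, hC⟩ := exists_eLpNorm_four_bessel_le
  exact ⟨Lp.aestronglyMeasurable _,
    (hC F).trans_lt (ENNReal.mul_lt_top ENNReal.coe_lt_top enorm_lt_top)⟩

theorem IsH1.memLp_four {f : L2} (hf : IsH1 f) : MemLp f 4 volume := by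
  obtain ⟨F, rfl⟩ := isH1_iff_exists_bessel.1 hf
  exact memLp_four_bessel F

theorem norm_toL4_pow {f : L2} (h : MemLp f 4 volume) : ‖toL4 f‖ ^ 4 = ∫ x, ‖f x‖ ^ 4 := by
  rw [L4_norm_pow]
  apply integral_congr_ae
  filter_upwards [coeFn_toL4 h] with x hx
  rw [hx]

theorem enorm_toL4 {f : L2} (h : MemLp f 4 volume) : ‖toL4 f‖ₑ = eLpNorm f 4 volume := by
  rw [Lp.enorm_def]
  exact eLpNorm_congr_ae (coeFn_toL4 h)

theorem toL4_add {f g : L2} (hf : MemLp f 4 volume) (hg : MemLp g 4 volume) :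
    toL4 (f + g) = toL4 f + toL4 g := by
  have hfg : MemLp (f + g : L2) 4 volume := (memLp_congr_ae (Lp.coeFn_add f g)).2 (hf.add hg)
  apply Lp.ext
  filter_upwards [coeFn_toL4 hf, coeFn_toL4 hg, coeFn_toL4 hfg, Lp.coeFn_add f g,
    Lp.coeFn_add (toL4 f) (toL4 g)] with x h1 h2 h3 h4 h5
  rw [h3, h4, h5, Pi.add_apply, Pi.add_apply, h1, h2]

theorem memLp_four_sum {ι : Type*} (s : Finset ι) {f : ι → L2}
    (hf : ∀ i ∈ s, MemLp (f i) 4 volume) : MemLp (∑ i ∈ s, f i : L2) 4 volume := by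
  classical
  induction s using Finset.induction_on with
  | empty =>
    rw [Finset.sum_empty]
    exact (memLp_congr_ae (Lp.coeFn_zero ℂ 2 (volume : Measure Space))).2 MemLp.zero
  | insert i s hi ih =>
    rw [Finset.sum_insert hi]
    exact (memLp_congr_ae (Lp.coeFn_add _ _)).2 ((hf i (Finset.mem_insert_self _ _)).add
      (ih fun j hj => hf j (Finset.mem_insert_of_mem hj)))

theorem toL4_sum {ι : Type*} (s : Finset ι) {f : ι → L2}
    (hf : ∀ i ∈ s, MemLp (f i) 4 volume) : toL4 (∑ i ∈ s, f i) = ∑ i ∈ s, toL4 (f i) := by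
  classical
  induction s using Finset.induction_on with
  | empty =>
    have h0 : MemLp (0 : L2) 4 (volume : Measure Space) := by
      simpa using memLp_four_sum (∅ : Finset ι) (f := f) (by simp)
    have := toL4_add h0 h0
    rw [add_zero, left_eq_add] at this
    simpa using this
  | insert i s hi ih =>
    have hs : ∀ j ∈ s, MemLp (f j) 4 volume := fun j hj => hf j (Finset.mem_insert_of_mem hj)
    rw [Finset.sum_insert hi, Finset.sum_insert hi,
      toL4_add (hf i (Finset.mem_insert_self _ _)) (memLp_four_sum s hs), ih hs]

theorem memLp_four_translate (a : Space) {f : L2} (hf : MemLp f 4 volume) :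
    MemLp (translate a f) 4 volume :=
  (memLp_congr_ae (coeFn_shift 2 a f)).2
    (hf.comp_measurePreserving (measurePreserving_sub_right volume a))

theorem toL4_translate (a : Space) {f : L2} (hf : MemLp f 4 volume) :
    toL4 (translate a f) = shift 4 a (toL4 f) := by
  apply Lp.ext
  have h := (measurePreserving_sub_right (volume : Measure Space) a).quasiMeasurePreserving.ae
    (coeFn_toL4 hf)
  filter_upwards [coeFn_toL4 (memLp_four_translate a hf), coeFn_shift 2 a f,
    coeFn_shift 4 a (toL4 f), h] with x h1 h2 h3 h4
  rw [h1, h3, h4]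
  exact h2

open scoped NNReal in
theorem exists_norm_toL4_bessel_le : ∃ C : ℝ≥0, ∀ F : L2, ‖toL4 (bessel F)‖ ≤ C * ‖F‖ := by
  obtain ⟨C, hC⟩ := exists_eLpNorm_four_bessel_le
  refine ⟨C, fun F => ?_⟩
  have h := hC F
  rw [← enorm_toL4 (memLp_four_bessel F)] at h
  have h' := ENNReal.toReal_mono (ENNReal.mul_ne_top ENNReal.coe_ne_top enorm_ne_top) h
  simpa using h'

theorem toL4_bessel_sub (F G : L2) :
    toL4 (bessel (F - G)) = toL4 (bessel F) - toL4 (bessel G) := by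
  rw [eq_sub_iff_add_eq, ← toL4_add (memLp_four_bessel _) (memLp_four_bessel _), ← bessel_add,
    sub_add_cancel]

theorem continuous_toL4_bessel : Continuous fun F : L2 => toL4 (bessel F) := by
  obtain ⟨C, hC⟩ := exists_norm_toL4_bessel_le
  refine LipschitzWith.continuous (K := C) (LipschitzWith.of_dist_le_mul fun F G => ?_)
  rw [dist_eq_norm, dist_eq_norm, ← toL4_bessel_sub]
  exact hC _

theorem continuous_toL4_schrodinger {f : L2} (hf : IsH1 f) :
    Continuous fun t => toL4 (schrodinger t f) := by
  obtain ⟨F, rfl⟩ := isH1_iff_exists_bessel.1 hf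
  simp only [schrodinger_bessel]
  exact continuous_toL4_bessel.comp (continuous_schrodinger F)

theorem exists_norm_toL4_schrodinger_le {f : L2} (hf : IsH1 f) :
    ∃ B, ∀ t, ‖toL4 (schrodinger t f)‖ ≤ B := by
  obtain ⟨F, rfl⟩ := isH1_iff_exists_bessel.1 hf
  obtain ⟨C, hC⟩ := exists_norm_toL4_bessel_le
  refine ⟨C * ‖F‖, fun t => ?_⟩
  rw [schrodinger_bessel, ← norm_schrodinger t F]
  exact hC _

/-! ### The dispersive estimate and decay in `L⁴`. -/

/-- The inverse Fourier transform on `L²` is given by the Fourier integral on `L¹ ∩ L²`. -/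
theorem coeFn_fourierInv_of_integrable {H : L2} {h : Space → ℂ} (hH : H =ᵐ[volume] h)
    (hint : Integrable h volume) : (𝓕⁻ H : L2) =ᵐ[volume] (𝓕⁻ h : Space → ℂ) := by
  have hcont : Continuous (𝓕⁻ h : Space → ℂ) := by
    have := VectorFourier.fourierIntegral_continuous (L := -innerₗ Space)
      Real.continuous_fourierChar (continuous_inner.neg) hint
    exact this
  -- Against a test function both inverse transforms can be moved onto it: the `L²` one by duality
  -- of distributions, the integral one by Fubini.
  apply ae_eq_of_integral_contDiff_smul_eq
  · exact (Lp.memLp _).locallyIntegrable (by norm_num)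
  · exact hcont.locallyIntegrable
  intro g g_smooth g_cpt
  have hg₁ : HasCompactSupport (Complex.ofRealCLM ∘ g) := g_cpt.comp_left rfl
  have hg₂ : ContDiff ℝ ((⊤ : ℕ∞) : WithTop ℕ∞) (Complex.ofRealCLM ∘ g) := by fun_prop
  let u : 𝓢(Space, ℂ) := hg₁.toSchwartzMap hg₂
  have hu : ∀ x, u x = (g x : ℂ) := fun x => rfl
  calc ∫ x, g x • (𝓕⁻ H : L2) x = ((𝓕⁻ H : L2) : 𝓢'(Space, ℂ)) u := by
        rw [Lp.toTemperedDistribution_apply]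
        simp [hu]
    _ = (H : 𝓢'(Space, ℂ)) (𝓕⁻ u) := by
        rw [← Lp.fourierInv_toTemperedDistribution_eq, TemperedDistribution.fourierInv_apply]
    _ = ∫ x, (𝓕⁻ u) x • h x := by
        rw [Lp.toTemperedDistribution_apply]
        apply integral_congr_ae
        filter_upwards [hH] with x hx
        rw [hx]
    _ = ∫ x, u x • (𝓕⁻ h : Space → ℂ) x := by
        have := VectorFourier.integral_fourierIntegral_smul_eq_flip (L := -innerₗ Space)
          (μ := volume) (ν := volume)
          Real.continuous_fourierChar (continuous_inner.neg) u.integrable hint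
        have hflip : (-innerₗ Space).flip = -innerₗ Space := by
          ext x y
          simp [real_inner_comm]
        rw [hflip] at this
        rw [SchwartzMap.fourierInv_coe]
        exact this
    _ = ∫ x, g x • (𝓕⁻ h : Space → ℂ) x := by simp only [hu, Complex.real_smul, smul_eq_mul]

/-- A Gaussian with complex parameter, `exp(-b|ξ|² + 2πi x·ξ)`. -/
def waveGaussian (b : ℂ) (x ξ : Space) : ℂ :=
  Complex.exp (-b * ‖ξ‖ ^ 2 + 2 * Real.pi * Complex.I * inner ℝ x ξ)

/-- The transform is again a Gaussian, whose exponent has nonpositive real part because `Re b⁻¹ ≥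
0`. The bound involves only `‖b‖`, so it survives `Re b → 0`. -/
theorem norm_fourier_waveGaussian_le {b : ℂ} (hb : 0 < b.re) (x w : Space) :
    ‖𝓕 (waveGaussian b x) w‖ ≤ (Real.pi / ‖b‖) ^ (3 / 2 : ℝ) := by
  have h := fourier_gaussian_innerProductSpace' hb x w
  rw [show (fun v : Space => Complex.exp (-b * ‖v‖ ^ 2 + 2 * Real.pi * Complex.I * inner ℝ x v)) =
    waveGaussian b x from rfl] at h
  have hfin : (Module.finrank ℝ Space / 2 : ℂ) = ((3 / 2 : ℝ) : ℂ) := by simp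
  rw [h, hfin, norm_mul, Complex.norm_cpow_real, norm_div, Complex.norm_real,
    Real.norm_of_nonneg Real.pi_pos.le]
  refine mul_le_of_le_one_right (by positivity) ?_
  rw [Complex.norm_exp, Real.exp_le_one_iff]
  have h2 : (-(Real.pi : ℂ) ^ 2 * (‖x - w‖ : ℂ) ^ 2 / b) =
      ((-(Real.pi ^ 2 * ‖x - w‖ ^ 2) : ℝ) : ℂ) * b⁻¹ := by
    push_cast
    ring
  rw [h2, Complex.re_ofReal_mul, Complex.inv_re]
  have : 0 ≤ b.re / Complex.normSq b := div_nonneg hb.le (Complex.normSq_nonneg b)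
  nlinarith [mul_nonneg (by positivity : 0 ≤ Real.pi ^ 2 * ‖x - w‖ ^ 2) this]

theorem integrable_waveGaussian {b : ℂ} (hb : 0 < b.re) (x : Space) :
    Integrable (waveGaussian b x) volume :=
  GaussianFourier.integrable_cexp_neg_mul_sq_norm_add hb (2 * Real.pi * Complex.I) x

/-- The multiplication formula moves the Fourier transform from `g` to the Gaussian, which leaves
the `L¹` norm of `g`. -/
theorem norm_integral_waveGaussian_mul_fourier_le {b : ℂ} (hb : 0 < b.re) (x : Space)
    (g : 𝓢(Space, ℂ)) :
    ‖∫ ξ, waveGaussian b x ξ * 𝓕 g ξ‖ ≤ (Real.pi / ‖b‖) ^ (3 / 2 : ℝ) * ∫ y, ‖g y‖ := by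
  have h := VectorFourier.integral_fourierIntegral_smul_eq_flip (L := innerₗ Space)
    (μ := volume) (ν := volume)
    Real.continuous_fourierChar continuous_inner (integrable_waveGaussian hb x) g.integrable
  have hflip : (innerₗ Space).flip = innerₗ Space := by
    ext x y
    simp
  rw [hflip] at h
  have h' : ∫ ξ, waveGaussian b x ξ * 𝓕 g ξ = ∫ w, 𝓕 (waveGaussian b x) w * g w := by
    rw [SchwartzMap.fourier_coe]
    exact h.symm
  rw [h', ← integral_const_mul]
  refine (norm_integral_le_integral_norm _).trans ?_
  refine integral_mono_of_nonneg (ae_of_all _ fun _ => norm_nonneg _)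
    (g.integrable.norm.const_mul _) (ae_of_all _ fun w => ?_)
  simp only [norm_mul]
  gcongr
  exact norm_fourier_waveGaussian_le hb x w

theorem norm_integral_schrodinger_le {t : ℝ} (ht : t ≠ 0) (x : Space) (g : 𝓢(Space, ℂ)) :
    ‖𝓕⁻ (fun ξ => schrodingerSymbol t ξ * 𝓕 g ξ) x‖ ≤
      (Real.pi / (4 * Real.pi ^ 2 * |t|)) ^ (3 / 2 : ℝ) * ∫ y, ‖g y‖ := by
  -- The Schrödinger symbol is the Gaussian with `b = 4π²it`, from `t(2π|ξ|)²`; adding `ε > 0` makes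
  -- it integrable.
  let b : ℝ → ℂ := fun ε => ε + ((4 * Real.pi ^ 2 * t : ℝ) : ℂ) * Complex.I
  have hbre : ∀ ε, (b ε).re = ε := fun ε => by
    simp only [b, Complex.add_re, Complex.ofReal_re, Complex.re_ofReal_mul, Complex.I_re, mul_zero,
      add_zero]
  have hbim : ∀ ε, (b ε).im = 4 * Real.pi ^ 2 * t := fun ε => by
    simp only [b, Complex.add_im, Complex.ofReal_im, Complex.im_ofReal_mul, Complex.I_im, mul_one,
      zero_add]
  have hlim : Tendsto (fun ε => ∫ ξ, waveGaussian (b ε) x ξ * 𝓕 g ξ) (𝓝[>] 0)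
      (𝓝 (∫ ξ, waveGaussian (b 0) x ξ * 𝓕 g ξ)) := by
    refine tendsto_integral_filter_of_dominated_convergence (fun ξ => ‖𝓕 g ξ‖) ?_ ?_
      (𝓕 g).integrable.norm ?_
    · refine Eventually.of_forall fun ε => Continuous.aestronglyMeasurable ?_
      have := (𝓕 g).continuous
      unfold waveGaussian
      fun_prop
    · filter_upwards [self_mem_nhdsWithin] with ε hε
      refine ae_of_all _ fun ξ => ?_
      rw [norm_mul]
      refine mul_le_of_le_one_left (norm_nonneg _) ?_
      rw [waveGaussian, Complex.norm_exp, Real.exp_le_one_iff]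
      have h1 : (-b ε * (‖ξ‖ : ℂ) ^ 2 + 2 * Real.pi * Complex.I * (inner ℝ x ξ : ℝ)).re =
          -ε * ‖ξ‖ ^ 2 := by
        rw [show (-b ε * (‖ξ‖ : ℂ) ^ 2 + 2 * Real.pi * Complex.I * (inner ℝ x ξ : ℝ)) =
          ((‖ξ‖ ^ 2 : ℝ) : ℂ) * (-b ε) + ((2 * Real.pi * inner ℝ x ξ : ℝ) : ℂ) * Complex.I by
          push_cast; ring, Complex.add_re, Complex.re_ofReal_mul, Complex.re_ofReal_mul,
          Complex.I_re, Complex.neg_re, hbre]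
        ring
      rw [h1]
      have hε' : (0 : ℝ) < ε := hε
      nlinarith [sq_nonneg ‖ξ‖]
    · refine ae_of_all _ fun ξ => ?_
      have : Continuous fun ε => waveGaussian (b ε) x ξ * 𝓕 g ξ := by
        unfold waveGaussian
        fun_prop
      exact (this.tendsto 0).mono_left nhdsWithin_le_nhds
  have hzero : 𝓕⁻ (fun ξ => schrodingerSymbol t ξ * 𝓕 g ξ) x =
      ∫ ξ, waveGaussian (b 0) x ξ * 𝓕 g ξ := by
    rw [Real.fourierInv_eq']
    congr 1
    ext ξ
    rw [smul_eq_mul, ← mul_assoc, schrodingerSymbol, waveGaussian, ← Complex.exp_add,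
      real_inner_comm]
    congr 2
    simp only [b]
    push_cast
    ring
  rw [hzero]
  refine le_of_tendsto hlim.norm ?_
  filter_upwards [self_mem_nhdsWithin] with ε hε
  have hε' : (0 : ℝ) < ε := hε
  refine (norm_integral_waveGaussian_mul_fourier_le (by rw [hbre]; exact hε') x g).trans ?_
  -- The imaginary part alone bounds `‖b ε‖` below, uniformly in `ε`.
  have hge : 4 * Real.pi ^ 2 * |t| ≤ ‖b ε‖ := by
    have := Complex.abs_im_le_norm (b ε)
    rwa [hbim, abs_mul, abs_of_pos (by positivity : 0 < 4 * Real.pi ^ 2)] at this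
  have ht' := abs_pos.2 ht
  gcongr

theorem eLpNorm_top_schrodinger_toLp_le {t : ℝ} (ht : t ≠ 0) (g : 𝓢(Space, ℂ)) :
    eLpNorm (schrodinger t (g.toLp 2 volume)) ∞ volume ≤
      ENNReal.ofReal ((Real.pi / (4 * Real.pi ^ 2 * |t|)) ^ (3 / 2 : ℝ) * ∫ y, ‖g y‖) := by
  have hH : mulTop (memLp_schrodingerSymbol t) (𝓕 (g.toLp 2 volume : L2)) =ᵐ[volume]
      fun ξ => schrodingerSymbol t ξ * 𝓕 g ξ := by
    rw [SchwartzMap.toLp_fourier_eq]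
    filter_upwards [coeFn_mulTop (memLp_schrodingerSymbol t) ((𝓕 g).toLp 2 volume),
      (𝓕 g).coeFn_toLp 2 volume] with ξ h1 h2
    rw [h1, h2]
  have hint : Integrable (fun ξ => schrodingerSymbol t ξ * 𝓕 g ξ) volume :=
    (𝓕 g).integrable.bdd_mul (memLp_schrodingerSymbol t).1
      (ae_of_all _ fun ξ => (norm_schrodingerSymbol t ξ).le)
  have h := coeFn_fourierInv_of_integrable hH hint
  refine eLpNormEssSup_le_of_ae_bound ?_
  filter_upwards [h] with x hx
  have hx' : schrodinger t (g.toLp 2 volume) x =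
    𝓕⁻ (fun ξ => schrodingerSymbol t ξ * 𝓕 g ξ) x := hx
  rw [hx']
  exact norm_integral_schrodinger_le ht x g

theorem isH1_toLp (g : 𝓢(Space, ℂ)) : IsH1 (g.toLp 2 volume) := by
  have := SchwartzMap.memSobolev (s := 1) (p := 2) g
  rwa [← Lp.toTemperedDistribution_toLp_eq (p := 2)] at this

/-- In `‖u‖₄² ≤ ‖u‖_∞ ‖u‖₂` the first factor decays like `|t|^{-3/2}` and the second is conserved.
-/
theorem tendsto_toL4_schrodinger_toLp (g : 𝓢(Space, ℂ)) :
    Tendsto (fun t => toL4 (schrodinger t (g.toLp 2 volume))) (cocompact ℝ) (𝓝 0) := by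
  set D : ℝ → ℝ := fun t => (Real.pi / (4 * Real.pi ^ 2 * |t|)) ^ (3 / 2 : ℝ) * ∫ y, ‖g y‖
  have hDlim : Tendsto D (cocompact ℝ) (𝓝 0) := by
    have h1 : Tendsto (fun t : ℝ => 4 * Real.pi ^ 2 * |t|) (cocompact ℝ) atTop :=
      (tendsto_norm_cocompact_atTop (E := ℝ)).const_mul_atTop (by positivity)
    have h2 := ((h1.const_div_atTop Real.pi).rpow_const
      (Or.inr (by norm_num : (0 : ℝ) ≤ 3 / 2))).mul_const (∫ y, ‖g y‖)
    rwa [Real.zero_rpow (by norm_num), zero_mul] at h2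
  have hle : ∀ᶠ t in cocompact ℝ, ‖toL4 (schrodinger t (g.toLp 2 volume))‖ ^ 2 ≤
      D t * ‖(g.toLp 2 volume : L2)‖ := by
    have hne : ∀ᶠ t : ℝ in cocompact ℝ, t ≠ 0 := by
      filter_upwards [(isCompact_singleton (x := (0 : ℝ))).compl_mem_cocompact] with t ht using ht
    filter_upwards [hne] with t ht
    have hD0 : 0 ≤ D t := mul_nonneg (by positivity) (integral_nonneg fun _ => norm_nonneg _)
    have h1 := eLpNorm_four_sq_le_top_two
      (Lp.aestronglyMeasurable (schrodinger t (g.toLp 2 volume)))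
    have h2 := h1.trans (mul_le_mul_left (eLpNorm_top_schrodinger_toLp_le ht g) _)
    rw [← enorm_toL4 ((isH1_toLp g).schrodinger t).memLp_four, ← Lp.enorm_def, ← ofReal_norm,
      ← ofReal_norm, norm_schrodinger, ← ENNReal.ofReal_mul hD0,
      ← ENNReal.ofReal_pow (norm_nonneg _)] at h2
    exact (ENNReal.ofReal_le_ofReal_iff (mul_nonneg hD0 (norm_nonneg _))).1 h2
  have hsq : Tendsto (fun t => ‖toL4 (schrodinger t (g.toLp 2 volume))‖ ^ 2) (cocompact ℝ)
      (𝓝 0) := by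
    refine squeeze_zero' (Eventually.of_forall fun t => sq_nonneg _) hle ?_
    simpa using hDlim.mul_const ‖(g.toLp 2 volume : L2)‖
  have hsqrt := hsq.sqrt
  simp only [Real.sqrt_sq (norm_nonneg _), Real.sqrt_zero] at hsqrt
  exact tendsto_zero_iff_norm_tendsto_zero.2 hsqrt

/-- The free evolution of an `H¹` function disperses in `L⁴`. -/
theorem tendsto_toL4_schrodinger {f : L2} (hf : IsH1 f) :
    Tendsto (fun t => toL4 (schrodinger t f)) (cocompact ℝ) (𝓝 0) := by
  obtain ⟨F, rfl⟩ := isH1_iff_exists_bessel.1 hf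
  obtain ⟨C, hC⟩ := exists_norm_toL4_bessel_le
  rw [Metric.tendsto_nhds]
  intro ε hε
  -- The approximation is made for `F` in `L²`: the flow commutes with `bessel` and is isometric, so
  -- the `L⁴` error is uniform in time. The `+ 1` guards against `C = 0`.
  obtain ⟨h, hh⟩ := (SchwartzMap.denseRange_toLpCLM (E := Space) (F := ℂ) (μ := volume) (p := 2)
    ENNReal.ofNat_ne_top).exists_dist_lt F (by positivity : 0 < ε / (2 * (C + 1)))
  have hh' : ‖F - h.toLp 2 volume‖ < ε / (2 * (C + 1)) := by
    rw [← dist_eq_norm]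
    exact hh
  have hlim := tendsto_toL4_schrodinger_toLp (besselSchwartz h)
  rw [← bessel_toLp] at hlim
  filter_upwards [Metric.tendsto_nhds.1 hlim (ε / 2) (by positivity)] with t ht
  rw [dist_zero_right] at ht ⊢
  have hsplit : toL4 (schrodinger t (bessel F)) =
      toL4 (schrodinger t (bessel (h.toLp 2 volume))) +
        toL4 (bessel (schrodinger t (F - h.toLp 2 volume))) := by
    rw [schrodinger_bessel, schrodinger_bessel,
      ← toL4_add (memLp_four_bessel _) (memLp_four_bessel _), ← bessel_add, ← schrodinger_add,
      add_sub_cancel]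
  rw [hsplit]
  have h1 : ‖toL4 (bessel (schrodinger t (F - h.toLp 2 volume)))‖ ≤ ε / 2 := by
    refine (hC _).trans ?_
    rw [norm_schrodinger]
    calc (C : ℝ) * ‖F - h.toLp 2 volume‖ ≤ (C + 1) * (ε / (2 * (C + 1))) := by
          gcongr
          linarith
      _ = ε / 2 := by field_simp
  linarith [norm_add_le (toL4 (schrodinger t (bessel (h.toLp 2 volume))))
    (toL4 (bessel (schrodinger t (F - h.toLp 2 volume))))]

/-! ### Strichartz control at time zero, `H¹` bounds and the energy. -/

theorem schrodinger_zero (f : L2) : schrodinger 0 f = f := by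
  apply fourier_injective
  apply Lp.ext
  filter_upwards [coeFn_fourier_schrodinger 0 f] with ξ h
  rw [h]
  simp [schrodingerSymbol]

/-- The pair `(∞, 3)` bounds the `L³` norm only at almost every time. Such times are dense, so `L²`
continuity of the flow and lower semicontinuity of the `L³` norm reach time `0`. -/
theorem eLpNorm_three_le_strichartzNorm {qmin rmax : ℝ≥0∞} (hr : 3 ≤ rmax) (f : L2) :
    eLpNorm f 3 volume ≤ strichartzNorm qmin rmax (fun τ => schrodinger τ f) := by
  have hadm : (2 / ∞ + 3 / 3 : ℝ≥0∞) = 1 ∧ (3 : ℝ≥0∞) ≤ 3 ∧ 3 ≤ rmax ∧ qmin ≤ ∞ := by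
    refine ⟨?_, le_rfl, hr, le_top⟩
    rw [ENNReal.div_top, zero_add, ENNReal.div_self (by simp) (by simp)]
  have hmix : mixedNorm ∞ 3 (fun τ => schrodinger τ f) ≤
      strichartzNorm qmin rmax (fun τ => schrodinger τ f) :=
    le_iSup_of_le ∞ (le_iSup_of_le 3 (le_iSup_of_le hadm le_rfl))
  refine le_trans ?_ hmix
  have hae : ∀ᵐ τ : ℝ, eLpNorm (schrodinger τ f) 3 volume ≤
      mixedNorm ∞ 3 (fun τ => schrodinger τ f) := by
    have := ae_le_eLpNormEssSup (μ := (volume : Measure ℝ))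
      (f := fun τ : ℝ => eLpNorm (schrodinger τ f) 3 volume)
    simpa [mixedNorm] using this
  have hdense := Measure.dense_of_ae hae
  have hne : (𝓝[{τ | eLpNorm (schrodinger τ f) 3 volume ≤
      mixedNorm ∞ 3 (fun τ => schrodinger τ f)}] (0 : ℝ)).NeBot :=
    mem_closure_iff_nhdsWithin_neBot.1 (hdense 0)
  have hlim := ((continuous_schrodinger f).tendsto 0).mono_left
    (nhdsWithin_le_nhds (s := {τ | eLpNorm (schrodinger τ f) 3 volume ≤
      mixedNorm ∞ 3 (fun τ => schrodinger τ f)}))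
  rw [schrodinger_zero] at hlim
  exact eLpNorm_le_of_tendstoInMeasure self_mem_nhdsWithin (tendstoInMeasure_of_tendsto_Lp hlim)
    fun τ => Lp.aestronglyMeasurable _

theorem IsH1.exists_bessel_norm_sq_le {f : L2} (hf : IsH1 f) {A : ℝ} (h0 : homSobolevSq 0 f ≤ A)
    (h1 : homSobolevSq 1 f ≤ A) : ∃ G, f = bessel G ∧ ‖G‖ ^ 2 ≤ 2 * A := by
  obtain ⟨G, rfl⟩ := isH1_iff_exists_bessel.1 hf
  refine ⟨G, rfl, ?_⟩
  rw [norm_sq_of_bessel]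
  have hA : 0 ≤ A := le_trans (by rw [homSobolevSq_zero]; positivity) h0
  have h2 : (2 * Real.pi)⁻¹ ^ 2 ≤ 1 :=
    pow_le_one₀ (by positivity) (inv_le_one_of_one_le₀ (by linarith [Real.pi_gt_three]))
  nlinarith [mul_le_mul h2 h1 (integral_nonneg fun ξ => by positivity) zero_le_one]

theorem homSobolevSq_nonneg (s : ℝ) (f : L2) : 0 ≤ homSobolevSq s f :=
  integral_nonneg fun ξ => by positivity

theorem homSobolevSq_le_of_h1Norm_le {f : L2} (hf : IsH1 f) {C : ℝ} (h : h1Norm f ≤ C) :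
    homSobolevSq 0 f ≤ C ^ 2 ∧ homSobolevSq 1 f ≤ C ^ 2 := by
  have h0 := homSobolevSq_nonneg 0 f
  have h1 := homSobolevSq_nonneg 1 f
  rw [h1Norm, integral_gradSq hf, ← L2_norm_sq, ← homSobolevSq_zero] at h
  have h2 := Real.sqrt_le_iff.1 h
  constructor <;> linarith [h2.2]

theorem energy_eq {f : L2} (hf : IsH1 f) :
    energy f = 1 / 2 * homSobolevSq 1 f - 1 / 4 * ‖toL4 f‖ ^ 4 := by
  rw [energy, integral_gradSq hf, norm_toL4_pow hf.memLp_four]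

/-! ### Additivity of the `L⁴` term along the expansion. -/

/-- Asymptotic additivity of the fourth power of the norm of `L⁴` along an expansion into
asymptotically orthogonal terms with a remainder that becomes small. -/
theorem tendsto_norm_pow_four_sub_of_expansion {a : ℕ → L4} {f w : ℕ → ℕ → L4} {D : ℕ → ℝ}
    {B : ℝ} (hD : ∀ j, 1 ≤ j → ∀ n, ‖f j n‖ ≤ D j)
    (hexp : ∀ K, 1 ≤ K → ∀ n, a n = ∑ j ∈ Finset.Icc 1 K, f j n + w K n)
    (hcross : ∀ j k, 1 ≤ j → 1 ≤ k → j ≠ k →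
      Tendsto (fun n => ‖mul44 (f j n) (f k n)‖) atTop (𝓝 0))
    (ha : ∀ n, ‖a n‖ ≤ B) (hw : ∀ K, 1 ≤ K → ∀ᶠ n in atTop, ‖w K n‖ ≤ B)
    (hsmall : ∀ δ > 0, ∀ᶠ K in atTop, ∀ᶠ n in atTop, ‖w K n‖ ≤ δ) {M : ℕ} (hM : 1 ≤ M) :
    Tendsto (fun n => ‖a n‖ ^ 4 - (∑ j ∈ Finset.Icc 1 M, ‖f j n‖ ^ 4 + ‖w M n‖ ^ 4))
      atTop (𝓝 0) := by
  have hB : 0 ≤ B := (norm_nonneg _).trans (ha 0)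
  rw [Metric.tendsto_nhds]
  intro ε hε
  -- `4(B + 1)³δ` is the cost of dropping `w K`. It is paid twice and orthogonality is used twice,
  -- hence four errors of `ε / 4`.
  obtain ⟨δ, hδ0, hδ1, hδ⟩ : ∃ δ > 0, δ ≤ 1 ∧ 4 * (B + 1) ^ 3 * δ < ε / 4 := by
    have hc : 0 < 16 * (B + 1) ^ 3 + 1 := by positivity
    refine ⟨min 1 (ε / (16 * (B + 1) ^ 3 + 1)), lt_min one_pos (by positivity), min_le_left _ _, ?_⟩
    have h1 : min 1 (ε / (16 * (B + 1) ^ 3 + 1)) ≤ ε / (16 * (B + 1) ^ 3 + 1) := min_le_right _ _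
    have h2 : ε / (16 * (B + 1) ^ 3 + 1) * (16 * (B + 1) ^ 3 + 1) = ε := by field_simp
    have h3 : 0 < ε / (16 * (B + 1) ^ 3 + 1) := by positivity
    have h4 : 4 * (B + 1) ^ 3 * min 1 (ε / (16 * (B + 1) ^ 3 + 1)) ≤
        4 * (B + 1) ^ 3 * (ε / (16 * (B + 1) ^ 3 + 1)) := by gcongr
    nlinarith
  obtain ⟨K, hK, hMK⟩ := ((hsmall δ hδ0).and (eventually_ge_atTop M)).exists
  have hsplit : ∀ {β : Type} [AddCommMonoid β] (g : ℕ → β), ∑ j ∈ Finset.Icc 1 K, g j =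
      ∑ j ∈ Finset.Icc 1 M, g j + ∑ j ∈ Finset.Ioc M K, g j := fun g => by
    rw [← Finset.sum_union]
    · congr 1
      ext j
      simp only [Finset.mem_Icc, Finset.mem_union, Finset.mem_Ioc]
      omega
    · rw [Finset.disjoint_left]
      intro j hj
      simp only [Finset.mem_Icc, Finset.mem_Ioc] at hj ⊢
      omega
  -- Comparing the expansions at `M` and `K` exhibits `w M` as the intermediate profiles plus a
  -- small term.
  have hwM : ∀ n, w M n = ∑ j ∈ Finset.Ioc M K, f j n + w K n := fun n => by
    have h1 := hexp M hM n
    rw [hexp K (hM.trans hMK) n, hsplit, add_assoc] at h1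
    exact (add_left_cancel h1).symm
  have hIcc : ∀ j ∈ Finset.Icc 1 K, 1 ≤ j := fun j hj => (Finset.mem_Icc.1 hj).1
  have hIoc : ∀ j ∈ Finset.Ioc M K, 1 ≤ j := fun j hj => by
    have := (Finset.mem_Ioc.1 hj).1
    omega
  have e1 := tendsto_norm_sum_pow_four_sub (l := atTop) f (Finset.Icc 1 K)
    (fun j hj => hD j (hIcc j hj)) (fun j hj k hk => hcross j k (hIcc j hj) (hIcc k hk))
  have e2 := tendsto_norm_sum_pow_four_sub (l := atTop) f (Finset.Ioc M K)
    (fun j hj => hD j (hIoc j hj)) (fun j hj k hk => hcross j k (hIoc j hj) (hIoc k hk))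
  filter_upwards [Metric.tendsto_nhds.1 e1 (ε / 4) (by positivity),
    Metric.tendsto_nhds.1 e2 (ε / 4) (by positivity), hK, hw M hM] with n h1 h2 h3 h4
  rw [Real.dist_eq, sub_zero] at h1 h2 ⊢
  have key : ∀ S : L4, ‖S + w K n‖ ≤ B → |‖S + w K n‖ ^ 4 - ‖S‖ ^ 4| < ε / 4 := by
    intro S hS
    -- Removing `w K` costs at most `δ ≤ 1`.
    have hS' : ‖S‖ ≤ B + 1 := by
      have := norm_sub_le (S + w K n) (w K n)
      rw [add_sub_cancel_right] at this
      linarith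
    refine (abs_norm_add_pow_four_sub_norm_pow_le S (w K n) (K := B + 1) (by linarith)
      hS').trans_lt (lt_of_le_of_lt ?_ hδ)
    gcongr
  have k1 := key (∑ j ∈ Finset.Icc 1 K, f j n) (by rw [← hexp K (hM.trans hMK) n]; exact ha n)
  have k2 := key (∑ j ∈ Finset.Ioc M K, f j n) (by rw [← hwM n]; exact h4)
  rw [← hexp K (hM.trans hMK) n] at k1
  rw [← hwM n] at k2
  rw [hsplit fun j => ‖f j n‖ ^ 4] at h1
  rw [abs_lt] at h1 h2 k1 k2 ⊢
  constructor <;> linarith [h1.1, h1.2, h2.1, h2.2, k1.1, k1.2, k2.1, k2.2]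

namespace IsProfileExpansion

variable {qmin rmax : ℝ≥0∞} {φ ψ : ℕ → L2} {t : ℕ → ℕ → ℝ} {x : ℕ → ℕ → Space}
  {W : ℕ → ℕ → L2}

/-- The Pythagorean hypothesis at `s = 0` and `s = 1`, with the nonnegative profile terms dropped,
bounds the remainders. The radius `R` does not depend on `K`; only the threshold in `n` does. -/
theorem exists_bessel_bound (h : IsProfileExpansion qmin rmax φ ψ t x W) :
    ∃ R : ℝ, 0 ≤ R ∧ (∀ n, ∃ G, φ n = bessel G ∧ ‖G‖ ≤ R) ∧
      ∀ K, 1 ≤ K → ∀ᶠ n in atTop, ∃ G, W K n = bessel G ∧ ‖G‖ ≤ R := by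
  obtain ⟨C, hC⟩ := h.seq_bounded
  have hφ := fun n => homSobolevSq_le_of_h1Norm_le (h.seq_mem n) (hC n)
  refine ⟨√(2 * (C ^ 2 + 1)), Real.sqrt_nonneg _, fun n => ?_, fun K hK => ?_⟩
  · obtain ⟨G, hG, hG'⟩ := (h.seq_mem n).exists_bessel_norm_sq_le (hφ n).1 (hφ n).2
    exact ⟨G, hG, Real.le_sqrt_of_sq_le (by linarith)⟩
  · have hW : ∀ s, 0 ≤ s → s ≤ 1 → (∀ n, homSobolevSq s (φ n) ≤ C ^ 2) →
        ∀ᶠ n in atTop, homSobolevSq s (W K n) ≤ C ^ 2 + 1 := by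
      intro s hs0 hs1 hs
      filter_upwards [(h.pythagoras K hK s hs0 hs1).eventually (lt_mem_nhds neg_one_lt_zero)]
        with n hn
      have := hs n
      have := Finset.sum_nonneg fun j (_ : j ∈ Finset.Icc 1 K) => homSobolevSq_nonneg s (ψ j)
      linarith
    filter_upwards [hW 0 le_rfl zero_le_one fun n => (hφ n).1,
      hW 1 zero_le_one le_rfl fun n => (hφ n).2] with n h0 h1
    obtain ⟨G, hG, hG'⟩ := (h.remainder_mem K hK n).exists_bessel_norm_sq_le h0 h1
    exact ⟨G, hG, Real.le_sqrt_of_sq_le hG'⟩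

/-- Interpolation of `L⁴` between `L³`, small by the Strichartz hypothesis, and `L⁶`, bounded
uniformly in `K` by Sobolev. -/
theorem eventually_norm_toL4_remainder_le (h : IsProfileExpansion qmin rmax φ ψ t x W)
    (hr : 3 ≤ rmax) {δ : ℝ} (hδ : 0 < δ) :
    ∀ᶠ K in atTop, ∀ᶠ n in atTop, ‖toL4 (W K n)‖ ≤ δ := by
  obtain ⟨R, hR, -, hW⟩ := h.exists_bessel_bound
  obtain ⟨C, hC⟩ := exists_eLpNorm_six_bessel_le
  -- The `L³` threshold for which the product with the `L⁶` bound `C * R` is at most `δ²`; the `+ 1`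
  -- keeps the denominator positive.
  have hη : 0 < δ ^ 2 / (C * R + 1) := by positivity
  filter_upwards [h.remainder_small.eventually (gt_mem_nhds (ENNReal.ofReal_pos.2 hη)),
    eventually_ge_atTop 1] with K hK hK1
  filter_upwards [eventually_lt_of_limsup_lt hK, hW K hK1] with n hn ⟨G, hG, hGR⟩
  have h3 := (eLpNorm_three_le_strichartzNorm (qmin := qmin) hr (W K n)).trans hn.le
  have h6 : eLpNorm (W K n) 6 volume ≤ ENNReal.ofReal (C * R) := by
    rw [hG]
    refine (hC G).trans ?_
    rw [ENNReal.ofReal_mul C.coe_nonneg, ENNReal.ofReal_coe_nnreal, ← ofReal_norm]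
    gcongr
  have h4 := (eLpNorm_four_sq_le_three_six (Lp.aestronglyMeasurable (W K n))).trans
    (mul_le_mul' h3 h6)
  rw [← enorm_toL4 (h.remainder_mem K hK1 n).memLp_four, ← ofReal_norm,
    ← ENNReal.ofReal_pow (norm_nonneg _), ← ENNReal.ofReal_mul hη.le,
    ENNReal.ofReal_le_ofReal_iff (by positivity)] at h4
  refine le_of_sq_le_sq (h4.trans ?_) hδ.le
  rw [div_mul_eq_mul_div, div_le_iff₀ (by positivity)]
  nlinarith [sq_nonneg δ]

theorem tendsto_norm_toL4_pow_sub (h : IsProfileExpansion qmin rmax φ ψ t x W) (hr : 3 ≤ rmax)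
    {M : ℕ} (hM : 1 ≤ M) :
    Tendsto (fun n => ‖toL4 (φ n)‖ ^ 4 - (∑ j ∈ Finset.Icc 1 M,
      ‖toL4 (schrodinger (-(t j n)) (ψ j))‖ ^ 4 + ‖toL4 (W M n)‖ ^ 4)) atTop (𝓝 0) := by
  obtain ⟨R, hR, hφR, hWR⟩ := h.exists_bessel_bound
  obtain ⟨C, hC⟩ := exists_norm_toL4_bessel_le
  have hD : ∀ j, ∃ D, 1 ≤ j → ∀ s, ‖toL4 (schrodinger s (ψ j))‖ ≤ D := fun j => by
    by_cases hj : 1 ≤ j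
    · obtain ⟨D, hD⟩ := exists_norm_toL4_schrodinger_le (h.profile_mem j hj)
      exact ⟨D, fun _ => hD⟩
    · exact ⟨0, fun h => absurd h hj⟩
  choose D hD using hD
  have hbound : ∀ {f G : L2}, f = bessel G → ‖G‖ ≤ R → ‖toL4 f‖ ≤ C * R := by
    rintro _ G rfl hG
    exact (hC G).trans (by gcongr)
  have key := tendsto_norm_pow_four_sub_of_expansion (a := fun n => toL4 (φ n))
    (f := fun j n => shift 4 (x j n) (toL4 (schrodinger (-(t j n)) (ψ j))))
    (w := fun K n => toL4 (W K n)) (D := D) (B := C * R)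
    (fun j hj n => by rw [norm_shift]; exact hD j hj _)
    (fun K hK n => by
      have hmem : ∀ j ∈ Finset.Icc 1 K, MemLp (schrodinger (-(t j n)) (ψ j)) 4 volume :=
        fun j hj => ((h.profile_mem j (Finset.mem_Icc.1 hj).1).schrodinger _).memLp_four
      have hmem' := fun j hj => memLp_four_translate (x j n) (hmem j hj)
      rw [h.expansion K hK n, toL4_add (memLp_four_sum _ hmem')
        (h.remainder_mem K hK n).memLp_four, toL4_sum _ hmem']
      congr 1
      exact Finset.sum_congr rfl fun j hj => toL4_translate _ (hmem j hj))
    (fun j k hj hk hjk =>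
      tendsto_norm_mul44_of_diverging (B := max (D j) (D k))
        (continuous_toL4_schrodinger (h.profile_mem j hj))
        (continuous_toL4_schrodinger (h.profile_mem k hk))
        (tendsto_toL4_schrodinger (h.profile_mem j hj))
        (tendsto_toL4_schrodinger (h.profile_mem k hk))
        (fun s => (hD j hj s).trans (le_max_left _ _))
        (fun s => (hD k hk s).trans (le_max_right _ _)) (h.divergence j k hj hk hjk))
    (fun n => by
      obtain ⟨G, hG, hGR⟩ := hφR n
      exact hbound hG hGR)
    (fun K hK => by
      filter_upwards [hWR K hK] with n ⟨G, hG, hGR⟩ using hbound hG hGR)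
    (fun δ hδ => h.eventually_norm_toL4_remainder_le hr hδ) hM
  simpa only [norm_shift] using key

end IsProfileExpansion

end NLS

end

theorem lemma2p2 (qmin rmax : ℝ≥0∞) (hq : 4 < qmin) (hr : 3 ≤ rmax) (hr' : rmax < 6)
    (φ : ℕ → NLS.L2) (ψ : ℕ → NLS.L2) (t : ℕ → ℕ → ℝ) (x : ℕ → ℕ → NLS.Space)
    (W : ℕ → ℕ → NLS.L2) (h : NLS.IsProfileExpansion qmin rmax φ ψ t x W) (M : ℕ) (hM : 1 ≤ M) :
    Tendsto (fun n => NLS.energy (φ n) -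
      (∑ j ∈ Finset.Icc 1 M, NLS.energy (NLS.schrodinger (-(t j n)) (ψ j)) + NLS.energy (W M n)))
      atTop (𝓝 0) := by
  have h1 := (h.pythagoras M hM 1 zero_le_one le_rfl).const_mul (1 / 2)
  have h2 := (h.tendsto_norm_toL4_pow_sub hr hM).const_mul (1 / 4)
  have h3 := h1.sub h2
  rw [mul_zero, mul_zero, sub_zero] at h3
  refine h3.congr fun n => ?_
  -- The hypothesis concerns `ψ j` and the energy its evolution; `Ḣ¹` invariance of the flow
  -- reconciles them, while the `L⁴` term keeps the time shift.
  have hsum : ∑ j ∈ Finset.Icc 1 M, NLS.energy (NLS.schrodinger (-(t j n)) (ψ j)) =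
      ∑ j ∈ Finset.Icc 1 M, (1 / 2 * NLS.homSobolevSq 1 (ψ j) -
        1 / 4 * ‖NLS.toL4 (NLS.schrodinger (-(t j n)) (ψ j))‖ ^ 4) :=
    Finset.sum_congr rfl fun j hj => by
      rw [NLS.energy_eq ((h.profile_mem j (Finset.mem_Icc.1 hj).1).schrodinger _),
        NLS.homSobolevSq_schrodinger]
  rw [hsum, NLS.energy_eq (h.seq_mem n), NLS.energy_eq (h.remainder_mem M hM n),
    Finset.sum_sub_distrib, ← Finset.mul_sum, ← Finset.mul_sum]
  ring
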